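/- Let $X$ be a compact simply connected smooth Riemannian manifold (without boundary) with Riemannian distance $d_X$, let $x_0\in X$ and let $n\ge 1$. Let $\Omega X$ be the space of loops $[0,1]\to X$ based at $x_0$, with the distance $d(\gamma_1,\gamma_2)=\sup_t d_X(\gamma_1(t),\gamma_2(t))$, and let $\tau:\pi_{n+1}(X)\otimes\mathbb Q\cong\pi_n(\Omega X)\otimes\mathbb Q\to H_n(\Omega X;\mathbb Q)$ be the composite of the adjunction isomorphism and the rational Hurewicz map. For $\alpha\in\pi_{n+1}(X)\otimes\mathbb Q$ and $L>0$, the distortion of $\alpha$ is $$\delta_\alpha(L)=\sup\{k\in\mathbb Q : \text{there is an } L\text{-Lipschitz map } f:S^{n+1}\to X \text{ with } [f]=k\alpha \text{ in } \pi_{n+1}(X)\otimes\mathbb Q\},$$ where $S^{n+1}$ is the round unit sphere with its Riemannian distance. For $z\in H_n(\Omega X;\mathbb Q)$, the homological distortion of $z$ is $$\delta'_z(L)=\sup\{k\in\mathbb Q : kz \text{ is represented by a cycle } Z \text{ with } \mathrm{Suplength}(Z)\le L \text{ and } \mathrm{Vol}(Z)\le L^n\}.$$ Both suprema are taken in $[-\infty,\infty]$.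 Here $Z=\sum_i q_i\sigma_i$ ranges over finite rational combinations of smooth simplices, that is, of maps $\sigma:\Delta^n\to\Omega X$ for which there is a partition $0=t_0<\dots<t_r=1$ such that $(w,t)\mapsto\sigma(w)(t)$ is smooth on each $\Delta^n\times[t_{j},t_{j+1}]$. The volume of $\sigma$ is the $n$-dimensional Hausdorff measure of its image in $\Omega X$, $\mathrm{Vol}(Z)=\sum_i|q_i|\,\mathrm{Vol}(\sigma_i)$, and $\mathrm{Suplength}(Z)$ is the supremum of the lengths of all loops in the images of the $\sigma_i$ with $q_i\ne0$. Then $\delta_\alpha(L)\lesssim\delta'_{\tau(\alpha)}(L)$, in the following sense: there is a constant $C>0$, depending only on $X$, $x_0$ and $n$, such that for all $\alpha\in\pi_{n+1}(X)\otimes\mathbb Q$ and all $L>0$ $$\delta_\alpha(L)\le\delta'_{\tau(\alpha)}(CL).$$ -/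

import Mathlib

open scoped unitInterval Topology Topology.Homotopy Manifold ContDiff ENNReal TensorProduct
open CategoryTheory AlgebraicTopology Simplicial Bundle

universe u

noncomputable section

namespace LoopDistortion

instance nontrivialFinSucc (n : ℕ) [NeZero n] : Nontrivial (Fin (n + 1)) :=
  Fin.nontrivial_iff_two_le.2 (Nat.succ_le_succ (Nat.one_le_iff_ne_zero.2 (NeZero.ne n)))

/-! ### Rational singular homology and explicit chains -/

/-- The coefficient module `ℚ`, lifted to the universe of the spaces. -/
abbrev coeff : ModuleCat.{u} ℚ := ModuleCat.of ℚ (ULift.{u} ℚ)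

section Homology

variable (Y : Type u) [TopologicalSpace Y] (n : ℕ)

/-- The rational singular chain complex of `Y`. -/
abbrev SingularComplex : ChainComplex (ModuleCat.{u} ℚ) ℕ :=
  ((singularChainComplexFunctor (ModuleCat.{u} ℚ)).obj coeff).obj (TopCat.of Y)

/-- Rational singular homology `H_n(Y; ℚ)`. -/
abbrev RatHomology : ModuleCat.{u} ℚ :=
  ((singularHomologyFunctor (ModuleCat.{u} ℚ) n).obj coeff).obj (TopCat.of Y)

/-- A singular `n`-simplex of `Y`. -/
abbrev Simplex : Type u := C(stdSimplex ℝ (Fin (n + 1)), Y)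

/-- A rational singular `n`-chain `∑ q_i ρ_i`, recorded through its coefficients. -/
abbrev Chain : Type u := Simplex Y n →₀ ℚ

variable {Y n}

/-- The element `1 · ρ` (more generally `q · ρ`) of the singular chain complex. -/
def simplexElement (ρ : Simplex Y n) (q : ℚ) : (SingularComplex Y).X n :=
  (SSet.ιChainComplex (X := TopCat.toSSet.obj (TopCat.of Y)) (R := coeff)
    ((TopCat.toSSetObjEquiv (TopCat.of Y) (Opposite.op ⦋n⦌)).symm ρ)).hom (ULift.up q)

/-- The element `∑ q_i ρ_i` of the singular chain complex. -/
def Chain.toComplex (Z : Chain Y n) : (SingularComplex Y).X n :=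
  Z.sum simplexElement

/-- `Z` is a cycle and its homology class is `z`. -/
def Chain.Represents (Z : Chain Y n) (z : RatHomology Y n) : Prop :=
  ∃ c : (SingularComplex Y).cycles n,
    ((SingularComplex Y).iCycles n).hom c = Z.toComplex ∧
    ((SingularComplex Y).homologyπ n).hom c = z

end Homology

/-! ### The Hurewicz map -/

/-- For a permutation `p` of the coordinates, the affine simplex of the cube with vertices
`0, e_{p 0}, e_{p 0} + e_{p 1}, …`. These `n!` simplices triangulate the cube. -/
def cubeSimplex {n : ℕ} (p : Equiv.Perm (Fin n)) :
    C(stdSimplex ℝ (Fin (n + 1)), I^ Fin n) where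
  toFun w i := ⟨∑ k with (p.symm i).castSucc < k, w.1 k,
    Finset.sum_nonneg fun k _ => w.2.1 k,
    (Finset.sum_le_univ_sum_of_nonneg fun k => w.2.1 k).trans_eq w.2.2⟩
  continuous_toFun := by
    refine continuous_pi fun i => Continuous.subtype_mk ?_ _
    exact continuous_finsetSum _ fun k _ => (continuous_apply k).comp continuous_subtype_val

/-- The image `g_*[I^n, ∂I^n]` of the fundamental chain of the cube, `∑_p sign(p) (g ∘ s_p)`. Its
class is the Hurewicz image of `[g]`. -/
def hurewiczChain {n : ℕ} {Y : Type u} [TopologicalSpace Y] {y : Y} (g : Ω^ (Fin n) Y y) :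
    Chain Y n :=
  ∑ p : Equiv.Perm (Fin n),
    Finsupp.single (g.1.comp (cubeSimplex p)) ((Equiv.Perm.sign p : ℤ) : ℚ)

section

variable {X : Type u} [TopologicalSpace X] {x₀ : X} {n : ℕ}

/-- The adjoint `I^n → ΩX`, `t ↦ (s ↦ g (s, t))`, of a map `g : (I^{n+1}, ∂I^{n+1}) → (X, x₀)`; it
realizes the isomorphism `π_{n+1}(X) ≅ π_n(ΩX)`. -/
def loopAdjoint (g : Ω^ (Fin (n + 1)) X x₀) : Ω^ (Fin n) (Path x₀ x₀) (Path.refl x₀) :=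
  ⟨{ toFun := fun t =>
      { toFun := fun s => g (Fin.cons s t : Fin (n + 1) → unitInterval)
        continuous_toFun := g.1.continuous.comp
          (continuous_pi (Fin.cases continuous_id fun _ => continuous_const))
        source' := g.2 _ ⟨0, Or.inl rfl⟩
        target' := g.2 _ ⟨0, Or.inr rfl⟩ }
     continuous_toFun := by
      refine continuous_induced_rng.2 (ContinuousMap.continuous_of_continuous_uncurry _ ?_)
      refine g.1.continuous.comp (continuous_pi (Fin.cases continuous_snd fun i => ?_))
      exact (continuous_apply i).comp continuous_fst },
   by
    rintro t ⟨i, hi⟩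
    ext s
    exact g.2 _ ⟨i.succ, by simpa using hi⟩⟩

variable (x₀ n) in
/-- `π_{n+1}(X, x₀) ⊗ ℚ` for `n ≥ 1`. -/
abbrev RatHomotopy [NeZero n] : Type u := ℚ ⊗[ℤ] Additive (π_ (n + 1) X x₀)

/-- The class of `g` in `π_{n+1}(X, x₀)`, with the group written additively. -/
def homotopyClass [NeZero n] (g : Ω^ (Fin (n + 1)) X x₀) : Additive (π_ (n + 1) X x₀) :=
  Additive.ofMul (Quotient.mk _ g : HomotopyGroup (Fin (n + 1)) X x₀)

/-- `z = τ(α)`, for the composite `τ : π_{n+1}(X) ⊗ ℚ ≅ π_n(ΩX) ⊗ ℚ → H_n(ΩX; ℚ)` of the adjunction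
and the rational Hurewicz map. Every `α` has the form `(1/m) [g]` with `m ≥ 1`, and then
`τ(α)` is `1/m` times the class of the cycle of the adjoint of `g`. -/
def IsHurewiczImage [NeZero n] (α : RatHomotopy x₀ n) (z : RatHomology (Path x₀ x₀) n) : Prop :=
  ∃ (m : ℕ) (g : Ω^ (Fin (n + 1)) X x₀), m ≠ 0 ∧
    (m : ℚ) • α = (1 : ℚ) ⊗ₜ[ℤ] homotopyClass g ∧
    (hurewiczChain (loopAdjoint g)).Represents ((m : ℚ) • z)

end

/-! ### Distortion of homotopy classes -/

/-- The round unit sphere `S^m`. -/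
abbrev RoundSphere (m : ℕ) : Type := Metric.sphere (0 : EuclideanSpace ℝ (Fin (m + 1))) 1

/-- The coordinates of the quotient map below: with `v = 2t - 1 ∈ [-1,1]^m` and
`b = ∏ (1 - v_i²)`, the inverse stereographic projection of `v / b ∈ ℝ^m ∪ {∞}`, that is
`(2 b v, |v|² - b²) / (|v|² + b²)`. -/
def collapseVec {m : ℕ} (t : I^ Fin m) : EuclideanSpace ℝ (Fin (m + 1)) :=
  let v : Fin m → ℝ := fun i => 2 * (t i : ℝ) - 1
  let b : ℝ := ∏ i, (1 - v i ^ 2)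
  let q : ℝ := ∑ i, v i ^ 2
  WithLp.toLp 2 (Fin.snoc (fun i => 2 * b * v i / (q + b ^ 2)) ((q - b ^ 2) / (q + b ^ 2)))

lemma norm_collapseVec {m : ℕ} (t : I^ Fin m) : ‖collapseVec t‖ = 1 := by
  rw [EuclideanSpace.norm_eq, Real.sqrt_eq_one, Fin.sum_univ_castSucc]
  simp only [collapseVec, Fin.snoc_castSucc, Fin.snoc_last, Real.norm_eq_abs, sq_abs]
  set v : Fin m → ℝ := fun i => 2 * (t i : ℝ) - 1 with hv
  set b : ℝ := ∏ i, (1 - v i ^ 2) with hb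
  set q : ℝ := ∑ i, v i ^ 2 with hq
  have hq0 : 0 ≤ q := Finset.sum_nonneg fun i _ => sq_nonneg _
  have hpos : 0 < q + b ^ 2 := by
    rcases hq0.eq_or_lt with h | h
    · have hz : ∀ i, v i ^ 2 = 0 := fun i =>
        (Finset.sum_eq_zero_iff_of_nonneg fun i _ => sq_nonneg (v i)).1 h.symm i
          (Finset.mem_univ i)
      have : b = 1 := by simp [hb, hz]
      rw [this]; linarith
    · positivity
  have : ∀ i, (2 * b * v i / (q + b ^ 2)) ^ 2 = (4 * b ^ 2 / (q + b ^ 2) ^ 2) * v i ^ 2 := by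
    intro i; rw [div_pow]; ring
  rw [Finset.sum_congr rfl fun i _ => this i, ← Finset.mul_sum, ← hq]
  field_simp
  ring

/-- The quotient map `I^m → I^m / ∂I^m ≅ S^m`, a homeomorphism from the open cube to the complement
of the pole that is the image of `∂I^m`. -/
def collapse {m : ℕ} (t : I^ Fin m) : RoundSphere m :=
  ⟨collapseVec t, by simpa using norm_collapseVec t⟩

section

variable {X : Type u} [MetricSpace X] {x₀ : X} {n : ℕ}

/-- The free map `f : S^{n+1} → X` has class `a ∈ π_{n+1}(X, x₀)`: the composite of `f` with the
quotient map from the cube is homotopic, through maps that are constant on the boundary of the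
cube, to a representative of `a`. For simply connected `X` each continuous `f` has exactly one
class. -/
def SphereClass [NeZero n] (f : RoundSphere (n + 1) → X) (a : Additive (π_ (n + 1) X x₀)) : Prop :=
  ∃ (g : Ω^ (Fin (n + 1)) X x₀) (H : C(unitInterval × (I^ Fin (n + 1)), X)),
    homotopyClass g = a ∧
    (∀ t, H (0, t) = f (collapse t)) ∧
    (∀ t, H (1, t) = g t) ∧
    ∀ s, ∀ t ∈ Cube.boundary (Fin (n + 1)), ∀ t' ∈ Cube.boundary (Fin (n + 1)), H (s, t) = H (s, t')

/-- `f` is `L`-Lipschitz for the Riemannian (great circle) distance of the unit sphere. -/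
def IsLipschitzOnSphere {m : ℕ} (f : RoundSphere m → X) (L : ℝ) : Prop :=
  ∀ p q : RoundSphere m, dist (f p) (f q) ≤ L * InnerProductGeometry.angle p.1 q.1

/-- The distortion `δ_α(L)`, the supremum of the `k` for which some `L`-Lipschitz map
`f : S^{n+1} → X` has `[f] = k α` in `π_{n+1}(X) ⊗ ℚ`. -/
def distortion [NeZero n] (α : RatHomotopy x₀ n) (L : ℝ) : EReal :=
  ⨆ (k : ℚ) (_ : ∃ (f : RoundSphere (n + 1) → X) (a : Additive (π_ (n + 1) X x₀)),
    IsLipschitzOnSphere f L ∧ SphereClass f a ∧ (1 : ℚ) ⊗ₜ[ℤ] a = k • α), ((k : ℝ) : EReal)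

/-! ### Volume and suplength of chains of loops -/

/-- The `n`-volume of a simplex of loops: the `n`-dimensional Hausdorff measure of its image, for
the distance `sup_t d(γ₁ t, γ₂ t)` of loops. -/
def simplexVolume (ρ : Simplex (Path x₀ x₀) n) : ℝ≥0∞ :=
  letI : MeasurableSpace C(unitInterval, X) := borel _
  haveI : BorelSpace C(unitInterval, X) := ⟨rfl⟩
  MeasureTheory.Measure.hausdorffMeasure (n : ℝ) (Set.range fun w => (ρ w).toContinuousMap)

/-- The volume `∑ |q_i| Vol(ρ_i)` of a chain `∑ q_i ρ_i`. -/
def Chain.volume (Z : Chain (Path x₀ x₀) n) : ℝ≥0∞ :=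
  Z.sum fun ρ q => ENNReal.ofReal |(q : ℝ)| * simplexVolume ρ

/-- The length of a loop. -/
def loopLength (γ : Path x₀ x₀) : ℝ≥0∞ := eVariationOn (γ : unitInterval → X) Set.univ

/-- The supremum of the lengths of the loops in the images of the simplices of a chain. -/
def Chain.suplength (Z : Chain (Path x₀ x₀) n) : ℝ≥0∞ :=
  ⨆ ρ ∈ Z.support, ⨆ w, loopLength (ρ w)

/-! ### Smooth chains of piecewise smooth loops and homological distortion -/

variable {d : ℕ} [ChartedSpace (EuclideanSpace ℝ (Fin d)) X]

variable (d) in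
/-- A smooth simplex of the space of piecewise smooth loops: for some partition
`0 = t_0 < ⋯ < t_r = 1` the adjoint map `Δ^n × [0,1] → X` is smooth on each
`Δ^n × [t_j, t_{j+1}]`. -/
def IsSmoothSimplex (ρ : Simplex (Path x₀ x₀) n) : Prop :=
  ∃ (r : ℕ) (t : Fin (r + 1) → ℝ), StrictMono t ∧ t 0 = 0 ∧ t (Fin.last r) = 1 ∧
    ∀ j : Fin r, ∃ F : (Fin (n + 1) → ℝ) × ℝ → X,
      ContMDiffOn 𝓘(ℝ, (Fin (n + 1) → ℝ) × ℝ) (𝓡 d) ∞ F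
        (stdSimplex ℝ (Fin (n + 1)) ×ˢ Set.Icc (t j.castSucc) (t j.succ)) ∧
      ∀ (w : stdSimplex ℝ (Fin (n + 1))) (s : unitInterval), (s : ℝ) ∈ Set.Icc (t j.castSucc) (t j.succ) →
        F (w.1, s) = ρ w s

variable (d) in
/-- The homological distortion `δ'_z(L)`, the supremum of the `k` for which `k z` is represented by
a smooth cycle of suplength at most `L` and volume at most `L^n`. -/
def homologicalDistortion (z : RatHomology (Path x₀ x₀) n) (L : ℝ) : EReal :=
  ⨆ (k : ℚ) (_ : ∃ Z : Chain (Path x₀ x₀) n, (∀ ρ ∈ Z.support, IsSmoothSimplex d ρ) ∧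
    Z.Represents (k • z) ∧ Z.suplength ≤ ENNReal.ofReal L ∧
    Z.volume ≤ ENNReal.ofReal (L ^ n)), ((k : ℝ) : EReal)

end

end LoopDistortion

end

/-! Precompose an `L`-Lipschitz map of the sphere with the collapse of the cube onto the sphere. The
adjoint is a cube of loops, parametrised in a Lipschitz way for the sup distance. Triangulate this
cube by its `n!` affine simplices. If the map of the cube is `K`-Lipschitz, every loop has length at
most `K`, and every simplex lies in a `K`-Lipschitz image of the unit `n`-cube, so it has volume at
most `K ^ n`. The resulting cycle is the Hurewicz image of the class, so its homology class is `k •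
z`.

Two points need work. The first is algebraic: the chain-level Hurewicz map is a well-defined
homomorphism, hence factors through the tensor product with the rationals (`d_cubeElement`,
`hurewiczMap_mul`, `represents_hurewiczChain`).

The second is geometric: the map of the cube must be made based and smooth without leaving its
class, with only a linear loss in the Lipschitz constant. A collar along a path to `x₀` makes it
based (`exists_isBased`). Mollification in finitely many charts then makes it smooth
(`SmoothingChart.exists_step`, `exists_smoothing`). Simple connectivity turns free homotopies into
based ones (`genLoop_homotopic_of_homotopicWith`). The collar adds a constant to the Lipschitz
constant. If `L` is bounded below this constant is absorbed into a multiple of `L`; if `L` is small,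
the image lies in a chart, the class is zero, and the zero chain suffices (`exists_smooth_genLoop`).
-/

noncomputable section

namespace LoopDistortion

/-! ### The boundary of the triangulated cube -/

section CubeBoundary

variable {Y : Type u} [TopologicalSpace Y] {n : ℕ}

/-- The `i`-th face inclusion of the topological simplex. -/
def simplexFace (i : Fin (n + 2)) :
    C(stdSimplex ℝ (Fin (n + 1)), stdSimplex ℝ (Fin (n + 2))) :=
  ⟨stdSimplex.map i.succAbove, stdSimplex.continuous_map _⟩

lemma toSSetObjEquiv_symm_face (ρ : Simplex Y (n + 1)) (i : Fin (n + 2)) :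
    (TopCat.toSSet.obj (TopCat.of Y)).δ i
      ((TopCat.toSSetObjEquiv (TopCat.of Y) (Opposite.op ⦋n + 1⦌)).symm ρ) =
    (TopCat.toSSetObjEquiv (TopCat.of Y) (Opposite.op ⦋n⦌)).symm (ρ.comp (simplexFace i)) :=
  rfl

lemma simplexElement_eq_smul (ρ : Simplex Y n) (q : ℚ) :
    simplexElement ρ q = q • simplexElement ρ 1 := by
  refine Eq.trans ?_ (LinearMap.map_smul (SSet.ιChainComplex (X := TopCat.toSSet.obj (TopCat.of Y))
    (R := coeff) ((TopCat.toSSetObjEquiv (TopCat.of Y) (Opposite.op ⦋n⦌)).symm ρ)).hom q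
      (ULift.up 1))
  refine congrArg (SSet.ιChainComplex (X := TopCat.toSSet.obj (TopCat.of Y))
    (R := coeff) ((TopCat.toSSetObjEquiv (TopCat.of Y) (Opposite.op ⦋n⦌)).symm ρ)).hom ?_
  exact ULift.ext _ _ (mul_one q).symm

lemma hom_neg_one_pow_smul {A B : ModuleCat.{u} ℚ} (f : A ⟶ B) (k : ℕ) (a : A) :
    ((-1 : ℤ) ^ k • f).hom a = (-1 : ℚ) ^ k • f.hom a := by
  rcases Nat.even_or_odd k with hk | hk <;> simp [hk.neg_one_pow]

lemma d_simplexElement (ρ : Simplex Y (n + 1)) (q : ℚ) :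
    ((SingularComplex Y).d (n + 1) n).hom (simplexElement ρ q) =
      ∑ i : Fin (n + 2), (-1 : ℚ) ^ (i : ℕ) • simplexElement (ρ.comp (simplexFace i)) q := by
  have h := SSet.ιChainComplex_d (X := TopCat.toSSet.obj (TopCat.of Y)) (R := coeff.{u})
    ((TopCat.toSSetObjEquiv (TopCat.of Y) (Opposite.op ⦋n + 1⦌)).symm ρ)
  have h2 := congrArg (fun f => f.hom (ULift.up q)) h
  refine Eq.trans (Eq.trans ?_ h2) ?_
  · rfl
  · simp only [ModuleCat.hom_sum, LinearMap.sum_apply]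
    refine Finset.sum_congr rfl fun i _ => ?_
    rw [toSSetObjEquiv_symm_face]
    exact hom_neg_one_pow_smul _ _ _

/-- The image of the fundamental chain of the cube under `G`. -/
def cubeElement (G : C(I^ Fin n, Y)) : (SingularComplex Y).X n :=
  ∑ p : Equiv.Perm (Fin n), ((Equiv.Perm.sign p : ℤ) : ℚ) • simplexElement (G.comp (cubeSimplex p)) 1

lemma toComplex_hurewiczChain {y : Y} (g : Ω^ (Fin n) Y y) :
    (hurewiczChain g).toComplex = cubeElement g.1 := by
  unfold Chain.toComplex hurewiczChain cubeElement
  rw [← Finsupp.sum_finsetSum_index]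
  · refine Finset.sum_congr rfl fun p _ => ?_
    rw [Finsupp.sum_single_index, simplexElement_eq_smul]
    rw [simplexElement_eq_smul, zero_smul]
  · intro a
    rw [simplexElement_eq_smul, zero_smul]
  · intro a b c
    rw [simplexElement_eq_smul, add_smul, ← simplexElement_eq_smul, ← simplexElement_eq_smul a c]

/-- The face `t_i = e` of the cube. -/
def cubeFace (i : Fin (n + 1)) (e : unitInterval) : C(I^ Fin n, I^ Fin (n + 1)) :=
  ⟨fun t => i.insertNth e t, by fun_prop⟩

/-- The face map gives vertex `l` weight zero and moves the other weights along `l.succAbove`. This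
formula reduces each face identity below to a comparison of index sets. -/
lemma cubeSimplex_face_apply (p : Equiv.Perm (Fin (n + 1))) (l : Fin (n + 2))
    (w : stdSimplex ℝ (Fin (n + 1))) (j : Fin (n + 1)) :
    (cubeSimplex p (simplexFace l w) (p j) : ℝ) =
      ∑ k with j.castSucc < l.succAbove k, w.1 k := by
  change ∑ k with (p.symm (p j)).castSucc < k, FunOnFinite.linearMap ℝ ℝ l.succAbove w k = _
  rw [Equiv.symm_apply_apply, Finset.sum_filter, Fin.sum_univ_succAbove _ l, Finset.sum_filter]
  have h0 : FunOnFinite.linearMap ℝ ℝ l.succAbove w l = 0 := by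
    rw [FunOnFinite.linearMap_apply_apply]
    apply Finset.sum_eq_zero
    intro x hx
    exact absurd (Finset.mem_filter.1 hx).2 (Fin.succAbove_ne _ _)
  have h1 : ∀ k, FunOnFinite.linearMap ℝ ℝ l.succAbove w (l.succAbove k) = w.1 k := by
    intro k
    rw [FunOnFinite.linearMap_apply_apply]
    rw [Finset.sum_eq_single k (by simp) (by simp)]
    rfl
  rw [h0]
  simp only [h1]
  simp

/-- The permutation with `0 ↦ i` and `j + 1 ↦ i.succAbove (q j)`. -/
def permCons (x : Fin (n + 1) × Equiv.Perm (Fin n)) : Equiv.Perm (Fin (n + 1)) :=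
  x.1.cycleRange.symm * Equiv.Perm.decomposeFin.symm (0, x.2)

@[simp] lemma permCons_zero (x : Fin (n + 1) × Equiv.Perm (Fin n)) : permCons x 0 = x.1 := by
  simp [permCons]

@[simp] lemma permCons_succ (x : Fin (n + 1) × Equiv.Perm (Fin n)) (j : Fin n) :
    permCons x j.succ = x.1.succAbove (x.2 j) := by
  simp [permCons]

lemma sign_permCons (x : Fin (n + 1) × Equiv.Perm (Fin n)) :
    Equiv.Perm.sign (permCons x) = (-1) ^ (x.1 : ℕ) * Equiv.Perm.sign x.2 := by
  rw [permCons, Equiv.Perm.sign_mul, Equiv.Perm.sign_symm, Fin.sign_cycleRange]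
  simp

lemma permCons_bijective : Function.Bijective (permCons (n := n)) := by
  rw [Fintype.bijective_iff_injective_and_card]
  constructor
  · rintro ⟨i, q⟩ ⟨i', q'⟩ h
    have h0 : i = i' := by simpa using congrArg (fun f => f 0) h
    subst h0
    congr 1
    ext j
    have := congrArg (fun f => f j.succ) h
    simp at this
    rw [this]
  · simp [Fintype.card_perm, Nat.factorial_succ]

lemma cubeSimplex_apply_perm (p : Equiv.Perm (Fin n)) (w : stdSimplex ℝ (Fin (n + 1)))
    (j : Fin n) : (cubeSimplex p w (p j) : ℝ) = ∑ k with j.castSucc < k, w.1 k := by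
  change ∑ k with (p.symm (p j)).castSucc < k, w.1 k = _
  rw [Equiv.symm_apply_apply]

/-- Every vertex other than the origin has coordinate `p 0` equal to `1`, so omitting vertex `0`
lands in a front face. -/
lemma cubeSimplex_permCons_comp_face (x : Fin (n + 1) × Equiv.Perm (Fin n)) :
    (cubeSimplex (permCons x)).comp (simplexFace 0) = (cubeFace x.1 1).comp (cubeSimplex x.2) := by
  ext w i
  obtain ⟨j, rfl⟩ := (permCons x).surjective i
  rw [ContinuousMap.comp_apply, cubeSimplex_face_apply]
  refine Fin.cases ?_ (fun j => ?_) j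
  · simp [cubeFace, w.2.2]
  · obtain ⟨i, q⟩ := x
    rw [permCons_succ]
    simp only [cubeFace, ContinuousMap.comp_apply, ContinuousMap.coe_mk, Fin.insertNth_apply_succAbove]
    rw [cubeSimplex_apply_perm]
    simp [Fin.castSucc_succ]

/-- Only the last vertex has a nonzero coordinate in the direction added last. The rotation makes
`x.1` that direction. -/
lemma cubeSimplex_permCons_rotate_comp_face (x : Fin (n + 1) × Equiv.Perm (Fin n)) :
    (cubeSimplex (permCons x * finRotate (n + 1))).comp (simplexFace (Fin.last (n + 1))) =
      (cubeFace x.1 0).comp (cubeSimplex x.2) := by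
  ext w i
  obtain ⟨j, rfl⟩ := (permCons x * finRotate (n + 1)).surjective i
  rw [ContinuousMap.comp_apply, cubeSimplex_face_apply]
  refine Fin.lastCases ?_ (fun j => ?_) j
  · simp only [Fin.succAbove_last, Fin.castSucc_lt_castSucc_iff]
    rw [Finset.sum_eq_zero]
    · simp [cubeFace]
    · intro k hk
      exact absurd (Finset.mem_filter.1 hk).2 (Fin.le_last k).not_gt
  · obtain ⟨i, q⟩ := x
    rw [Equiv.Perm.mul_apply, finRotate_apply, Fin.coeSucc_eq_succ, permCons_succ]
    simp only [cubeFace, ContinuousMap.comp_apply, ContinuousMap.coe_mk, Fin.insertNth_apply_succAbove]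
    rw [cubeSimplex_apply_perm]
    simp

/-- The order in which two consecutive directions are added affects only the vertex between them,
which this face omits. -/
lemma cubeSimplex_swap_comp_face (p : Equiv.Perm (Fin (n + 1))) (l : Fin n) :
    (cubeSimplex (p * Equiv.swap l.castSucc l.succ)).comp (simplexFace l.castSucc.succ) =
      (cubeSimplex p).comp (simplexFace l.castSucc.succ) := by
  ext w i
  obtain ⟨j, rfl⟩ := (p * Equiv.swap l.castSucc l.succ).surjective i
  rw [ContinuousMap.comp_apply, cubeSimplex_face_apply, Equiv.Perm.mul_apply,
    ContinuousMap.comp_apply, cubeSimplex_face_apply]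
  have key : ∀ k : Fin (n + 1), (l.castSucc.castSucc < l.castSucc.succ.succAbove k ↔
      l.succ.castSucc < l.castSucc.succ.succAbove k) := by
    intro k
    have h1 := Fin.succAbove_ne l.castSucc.succ k
    simp only [Fin.lt_def, ne_eq, Fin.ext_iff, Fin.val_castSucc, Fin.val_succ] at h1 ⊢
    omega
  rw [Equiv.swap_apply_def]
  split_ifs with h1 h2
  · subst h1; simp only [key]
  · subst h2; simp only [key]
  · rfl

/-- The boundary of the cube chain. -/
theorem d_cubeElement (G : C(I^ Fin (n + 1), Y)) :
    ((SingularComplex Y).d (n + 1) n).hom (cubeElement G) =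
      ∑ i : Fin (n + 1), (-1 : ℚ) ^ (i : ℕ) •
        (cubeElement (G.comp (cubeFace i 1)) - cubeElement (G.comp (cubeFace i 0))) := by
  set A : Fin (n + 2) → (SingularComplex Y).X n := fun l => ∑ p : Equiv.Perm (Fin (n + 1)),
    ((Equiv.Perm.sign p : ℤ) : ℚ) •
      simplexElement ((G.comp (cubeSimplex p)).comp (simplexFace l)) 1 with hA
  have h1 : ((SingularComplex Y).d (n + 1) n).hom (cubeElement G) =
      ∑ l : Fin (n + 2), (-1 : ℚ) ^ (l : ℕ) • A l := by
    unfold cubeElement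
    rw [map_sum]
    simp only [map_smul, d_simplexElement, hA, Finset.smul_sum]
    rw [Finset.sum_comm]
    exact Finset.sum_congr rfl fun l _ => Finset.sum_congr rfl fun p _ => smul_comm _ _ _
  -- Each inner face is shared by `p` and `p` times a transposition, which have opposite signs;
  -- hence `A = -A`, and `2` is invertible.
  have hmid : ∀ l : Fin n, A l.castSucc.succ = 0 := by
    intro l
    have h : A l.castSucc.succ = - A l.castSucc.succ := by
      conv_lhs => rw [hA]
      simp only
      rw [← Equiv.sum_comp (Equiv.mulRight (Equiv.swap l.castSucc l.succ)), hA,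
        ← Finset.sum_neg_distrib]
      refine Finset.sum_congr rfl fun p _ => ?_
      rw [Equiv.coe_mulRight, ContinuousMap.comp_assoc, cubeSimplex_swap_comp_face,
        Equiv.Perm.sign_mul, Equiv.Perm.sign_swap (Fin.castSucc_lt_succ).ne,
        ContinuousMap.comp_assoc]
      simp
    have h2 : (2 : ℚ) • A l.castSucc.succ = 0 := by
      rw [two_smul]
      nth_rewrite 1 [h]
      exact neg_add_cancel _
    exact (smul_eq_zero.1 h2).resolve_left two_ne_zero
  have hfst : A 0 = ∑ i : Fin (n + 1), (-1 : ℚ) ^ (i : ℕ) • cubeElement (G.comp (cubeFace i 1)) := by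
    rw [hA]
    simp only
    rw [← Equiv.sum_comp (Equiv.ofBijective _ permCons_bijective), Fintype.sum_prod_type]
    refine Finset.sum_congr rfl fun i _ => ?_
    unfold cubeElement
    rw [Finset.smul_sum]
    refine Finset.sum_congr rfl fun q _ => ?_
    rw [Equiv.ofBijective_apply, ContinuousMap.comp_assoc, cubeSimplex_permCons_comp_face,
      sign_permCons, smul_smul, ContinuousMap.comp_assoc]
    simp
  have hlast : A (Fin.last (n + 1)) = (-1 : ℚ) ^ n •
      ∑ i : Fin (n + 1), (-1 : ℚ) ^ (i : ℕ) • cubeElement (G.comp (cubeFace i 0)) := by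
    rw [hA]
    simp only
    rw [← Equiv.sum_comp ((Equiv.ofBijective _ permCons_bijective).trans
      (Equiv.mulRight (finRotate (n + 1)))), Fintype.sum_prod_type, Finset.smul_sum]
    refine Finset.sum_congr rfl fun i _ => ?_
    unfold cubeElement
    rw [Finset.smul_sum, Finset.smul_sum]
    refine Finset.sum_congr rfl fun q _ => ?_
    rw [Equiv.trans_apply, Equiv.ofBijective_apply, Equiv.coe_mulRight, ContinuousMap.comp_assoc,
      cubeSimplex_permCons_rotate_comp_face, Equiv.Perm.sign_mul, sign_permCons, sign_finRotate,
      smul_smul, smul_smul, ContinuousMap.comp_assoc]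
    congr 1
    push_cast
    ring
  rw [h1, Fin.sum_univ_succ, Fin.sum_univ_castSucc]
  simp only [hmid, smul_zero, Finset.sum_const_zero, zero_add]
  rw [hfst, Fin.succ_last, hlast, smul_smul]
  -- The face sign `(-1) ^ (n + 1)` meets the sign `(-1) ^ n` of the rotation.
  have hs : (-1 : ℚ) ^ ((Fin.last (n + 1) : Fin (n + 2)) : ℕ) * (-1) ^ n = -1 := by
    rw [Fin.val_last, ← pow_add]
    exact Odd.neg_one_pow ⟨n, by ring⟩
  rw [hs]
  simp only [smul_sub, Finset.sum_sub_distrib, Fin.val_zero, pow_zero, one_smul, neg_smul]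
  rw [sub_eq_add_neg]

end CubeBoundary

end LoopDistortion
end

noncomputable section

namespace LoopDistortion

/-! ### Homology classes of explicit cycles -/

section Classes

/-- `x` is a cycle whose homology class is `z`. -/
def IsClassOf (K : ChainComplex (ModuleCat.{u} ℚ) ℕ) {n : ℕ} (x : K.X n) (z : K.homology n) :
    Prop :=
  ∃ c : K.cycles n, (K.iCycles n).hom c = x ∧ (K.homologyπ n).hom c = z

variable {K : ChainComplex (ModuleCat.{u} ℚ) ℕ} {n : ℕ}

/-- Cycles inject into chains, so the chain determines the class. This makes the Hurewicz map
independent of the choices in its construction. -/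
lemma IsClassOf.unique {x : K.X n} {z z' : K.homology n} (h : IsClassOf K x z)
    (h' : IsClassOf K x z') : z = z' := by
  obtain ⟨c, hc, rfl⟩ := h
  obtain ⟨c', hc', rfl⟩ := h'
  have : Function.Injective (K.iCycles n).hom :=
    (ModuleCat.mono_iff_injective (K.iCycles n)).1 inferInstance
  rw [this (hc.trans hc'.symm)]

lemma IsClassOf.add {x y : K.X n} {z w : K.homology n} (hx : IsClassOf K x z)
    (hy : IsClassOf K y w) : IsClassOf K (x + y) (z + w) := by
  obtain ⟨c, rfl, rfl⟩ := hx
  obtain ⟨c', rfl, rfl⟩ := hy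
  exact ⟨c + c', map_add _ _ _, map_add _ _ _⟩

lemma IsClassOf.smul {x : K.X n} {z : K.homology n} (hx : IsClassOf K x z) (q : ℚ) :
    IsClassOf K (q • x) (q • z) := by
  obtain ⟨c, rfl, rfl⟩ := hx
  exact ⟨q • c, map_smul _ _ _, map_smul _ _ _⟩

lemma IsClassOf.boundary (b : K.X (n + 1)) : IsClassOf K ((K.d (n + 1) n).hom b) 0 := by
  refine ⟨(K.toCycles (n + 1) n).hom b, ?_, ?_⟩
  · rw [← LinearMap.comp_apply, ← ModuleCat.hom_comp, K.toCycles_i]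
  · rw [← LinearMap.comp_apply, ← ModuleCat.hom_comp, K.toCycles_comp_homologyπ]
    rfl

lemma IsClassOf.exists_of_d_eq_zero (x : K.X (n + 1)) (h : (K.d (n + 1) n).hom x = 0) :
    ∃ z, IsClassOf K x z :=
  ⟨_, K.cyclesMk x n (by simp) h, K.i_cyclesMk x n (by simp) h, rfl⟩

end Classes

/-! ### The Hurewicz homomorphism of the loop space -/

section Hurewicz

variable {Y : Type u} [TopologicalSpace Y] {y : Y} {n : ℕ}

@[simp] lemma cubeFace_apply (i : Fin (n + 1)) (e : unitInterval) (t : I^ Fin n) :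
    cubeFace i e t = i.insertNth e t := rfl

/-- If opposite side faces agree, the boundary of the cube chain is top minus bottom. -/
lemma d_cubeElement_of_sides (G : C(I^ Fin (n + 1), Y))
    (h : ∀ j : Fin n, G.comp (cubeFace j.succ 1) = G.comp (cubeFace j.succ 0)) :
    ((SingularComplex Y).d (n + 1) n).hom (cubeElement G) =
      cubeElement (G.comp (cubeFace 0 1)) - cubeElement (G.comp (cubeFace 0 0)) := by
  rw [d_cubeElement, Fin.sum_univ_succ]
  simp [h]

lemma d_cubeElement_genLoop (g : Ω^ (Fin (n + 1)) Y y) :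
    ((SingularComplex Y).d (n + 1) n).hom (cubeElement g.1) = 0 := by
  rw [d_cubeElement]
  refine Finset.sum_eq_zero fun i _ => ?_
  have : ∀ e : unitInterval, e = 0 ∨ e = 1 → g.1.comp (cubeFace i e) = ContinuousMap.const _ y := by
    intro e he
    ext t
    exact g.2 _ ⟨i, by simpa only [cubeFace_apply, Fin.insertNth_apply_same] using he⟩
  rw [this 0 (Or.inl rfl), this 1 (Or.inr rfl), sub_self, smul_zero]

/-- Time is taken as coordinate `0` of a cube of one dimension more. Its side faces are constant, so
they cancel in pairs. -/
lemma exists_d_eq_cubeElement_sub (H : C(unitInterval × (I^ Fin n), Y))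
    (h : ∀ s, ∀ t ∈ Cube.boundary (Fin n), H (s, t) = y) :
    ∃ b, ((SingularComplex Y).d (n + 1) n).hom b =
      cubeElement (H.comp ((ContinuousMap.const _ 1).prodMk (ContinuousMap.id _))) -
      cubeElement (H.comp ((ContinuousMap.const _ 0).prodMk (ContinuousMap.id _))) := by
  let G : C(I^ Fin (n + 1), Y) := ⟨fun t => H (t 0, Fin.tail t), by
    refine H.continuous.comp ((continuous_apply 0).prodMk ?_)
    exact continuous_pi fun i => continuous_apply _⟩
  refine ⟨cubeElement G, ?_⟩
  rw [d_cubeElement_of_sides]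
  · congr 2
  · intro j
    ext t
    have : ∀ e : unitInterval, e = 0 ∨ e = 1 → G.comp (cubeFace j.succ e) t = y := by
      intro e he
      refine h _ _ ⟨j, ?_⟩
      simpa [Fin.tail, cubeFace] using he
    rw [this 0 (Or.inl rfl), this 1 (Or.inr rfl)]

/-- In dimension one, the constant edge bounds the constant triangle, since `1 - 1 + 1 = 1`. In
higher dimensions the signs of the permutations already sum to zero. -/
lemma exists_d_eq_cubeElement_const (y : Y) :
    ∃ b, ((SingularComplex Y).d (n + 2) (n + 1)).hom b =
      cubeElement (ContinuousMap.const (I^ Fin (n + 1)) y) := by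
  rcases n with _ | n
  · refine ⟨simplexElement (ContinuousMap.const _ y) 1, ?_⟩
    rw [d_simplexElement, Fin.sum_univ_three]
    simp only [ContinuousMap.const_comp]
    simp [cubeElement, ContinuousMap.const_comp]
  · refine ⟨0, ?_⟩
    rw [map_zero, eq_comm]
    unfold cubeElement
    simp only [ContinuousMap.const_comp]
    rw [← Finset.sum_smul]
    have : ∑ p : Equiv.Perm (Fin (n + 2)), ((Equiv.Perm.sign p : ℤ) : ℚ) = 0 := by
      have h : ∑ p : Equiv.Perm (Fin (n + 2)), ((Equiv.Perm.sign p : ℤ) : ℚ) =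
          - ∑ p : Equiv.Perm (Fin (n + 2)), ((Equiv.Perm.sign p : ℤ) : ℚ) := by
        conv_lhs => rw [← Equiv.sum_comp (Equiv.mulRight (Equiv.swap 0 1))]
        rw [← Finset.sum_neg_distrib]
        refine Finset.sum_congr rfl fun p _ => ?_
        simp
      linarith
    rw [this, zero_smul]

/-- The bilinear reparametrization `(s, t) ↦ t + (1 - t) s / 2`. -/
def shearParam (s t : unitInterval) : unitInterval :=
  ⟨t + (1 - t) * s / 2, by
    have hs := s.2; have ht := t.2
    constructor <;> nlinarith [hs.1, hs.2, ht.1, ht.2, mul_nonneg (sub_nonneg.2 ht.2) hs.1,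
      mul_nonneg (sub_nonneg.2 ht.2) (sub_nonneg.2 hs.2)]⟩

/-- The concatenation is pulled back along the shear of the first two coordinates `(s, t)`. The
faces `s = 0` and `s = 1` give the concatenation and `g`; the faces `t = 0` and `t = 1` give `f` and
a constant. All other faces are constant and cancel. -/
lemma exists_d_eq_cubeElement_transAt (f g : Ω^ (Fin (n + 1)) Y y) :
    ∃ b, ((SingularComplex Y).d (n + 2) (n + 1)).hom b =
      cubeElement f.1 + cubeElement g.1 - cubeElement (GenLoop.transAt 0 f g).1 -
        cubeElement (ContinuousMap.const (I^ Fin (n + 1)) y) := by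
  let ψ : C(I^ Fin (n + 2), I^ Fin (n + 1)) :=
    ⟨fun u => Fin.cons (shearParam (u 0) (u 1)) (Fin.tail (Fin.tail u)), by
      refine continuous_pi (Fin.cases ?_ fun i => continuous_apply _)
      refine Continuous.subtype_mk ?_ _
      fun_prop⟩
  let a := GenLoop.transAt 0 f g
  have ha : ∀ t, a t = if (t 0 : ℝ) ≤ 1 / 2
      then f (Function.update t 0 <| Set.projIcc 0 1 zero_le_one (2 * t 0))
      else g (Function.update t 0 <| Set.projIcc 0 1 zero_le_one (2 * t 0 - 1)) := fun t => rfl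
  refine ⟨cubeElement (a.1.comp ψ), ?_⟩
  have e00 : (a.1.comp ψ).comp (cubeFace 0 0) = a.1 := by
    ext t
    change a (ψ _) = a t
    congr 1
    ext i
    refine Fin.cases ?_ (fun i => ?_) i
    · simp [ψ, cubeFace, shearParam]
    · simp [ψ, cubeFace, Fin.tail]
  have hψ : ∀ u, ψ u = Fin.cons (shearParam (u 0) (u 1)) (Fin.tail (Fin.tail u)) := fun _ => rfl
  have e01 : (a.1.comp ψ).comp (cubeFace 0 1) = g.1 := by
    ext t
    change a (ψ _) = g t
    have h0 : ((shearParam 1 (t 0) : unitInterval) : ℝ) = (1 + t 0) / 2 := by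
      simp [shearParam]; ring
    have hu : ψ (cubeFace 0 1 t) = Fin.cons (shearParam 1 (t 0)) (Fin.tail t) := by
      rw [hψ, cubeFace_apply, Fin.insertNth_zero']
      rfl
    rw [ha, hu]
    simp only [Fin.cons_zero, h0]
    split_ifs with hle
    -- At the midpoint the `f` branch of the concatenation is taken, but there both loops have the
    -- value `y`.
    · have ht : t 0 = 0 := Subtype.ext (le_antisymm (by simpa using (by linarith : (t 0 : ℝ) ≤ 0))
        (t 0).2.1)
      refine Eq.trans (b := y) (f.2 _ ⟨0, Or.inr ?_⟩) (g.2 t ⟨0, Or.inl ht⟩).symm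
      simp [ht]
    · congr 1
      ext i
      refine Fin.cases ?_ (fun i => ?_) i
      · rw [Function.update_self]
        have : 2 * ((1 + (t 0 : ℝ)) / 2) - 1 = t 0 := by ring
        rw [this, Set.projIcc_val]
      · rw [Function.update_of_ne (Fin.succ_ne_zero i)]
        simp [Fin.tail]
  have e10 : (a.1.comp ψ).comp (cubeFace 1 0) = f.1 := by
    ext t
    change a (ψ _) = f t
    have h0 : ((shearParam (t 0) 0 : unitInterval) : ℝ) = t 0 / 2 := by
      simp [shearParam]
    have h1 : (Fin.insertNth 1 0 t : Fin (n + 2) → unitInterval) 0 = t 0 :=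
      Fin.insertNth_apply_succAbove (α := fun _ => unitInterval) 1 0 t 0
    rw [ha, hψ]
    simp only [cubeFace_apply, Fin.insertNth_apply_same, Fin.cons_zero, h1, h0]
    rw [if_pos (by linarith [(t 0).2.2])]
    congr 1
    ext i
    refine Fin.cases ?_ (fun i => ?_) i
    · rw [Function.update_self]
      have : 2 * ((t 0 : ℝ) / 2) = t 0 := by ring
      rw [this, Set.projIcc_val]
    · rw [Function.update_of_ne (Fin.succ_ne_zero i)]
      have h2 : (Fin.insertNth 1 0 t : Fin (n + 2) → unitInterval) i.succ.succ = t i.succ :=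
        Fin.insertNth_apply_succAbove (α := fun _ => unitInterval) 1 0 t i.succ
      simp [Fin.tail, h2]
  have e11 : (a.1.comp ψ).comp (cubeFace 1 1) = ContinuousMap.const _ y := by
    ext t
    refine a.2 _ ⟨0, Or.inr ?_⟩
    ext
    simp [ψ, cubeFace, shearParam]
  rw [d_cubeElement, Fin.sum_univ_succ, Fin.sum_univ_succ, Finset.sum_eq_zero]
  · simp [e00, e01, e10, e11]
    abel
  · intro j _
    have : ∀ e : unitInterval, e = 0 ∨ e = 1 →
        (a.1.comp ψ).comp (cubeFace j.succ.succ e) = ContinuousMap.const _ y := by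
      intro e he
      ext t
      refine a.2 _ ⟨j.succ, ?_⟩
      simpa [Fin.tail, cubeFace, ψ] using he
    rw [this 0 (Or.inl rfl), this 1 (Or.inr rfl), sub_self, smul_zero]

variable {X : Type u} [TopologicalSpace X] {x₀ : X}

lemma exists_d_eq_cubeElement_of_homotopic {f g : Ω^ (Fin (n + 1)) X x₀}
    (h : GenLoop.Homotopic f g) :
    ∃ b, ((SingularComplex (Path x₀ x₀)).d (n + 1) n).hom b =
      cubeElement (loopAdjoint g).1 - cubeElement (loopAdjoint f).1 := by
  obtain ⟨H⟩ := h
  have hcont : Continuous fun q : (unitInterval × (I^ Fin n)) × unitInterval =>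
      H (q.1.1, (Fin.cons q.2 q.1.2 : Fin (n + 1) → unitInterval)) := by
    refine H.continuous.comp ((continuous_fst.comp continuous_fst).prodMk
      (continuous_pi (Fin.cases continuous_snd fun i => ?_)))
    exact (continuous_apply i).comp (continuous_snd.comp continuous_fst)
  have hb : ∀ s, ∀ t ∈ Cube.boundary (Fin (n + 1)), H (s, t) = x₀ := fun s t ht =>
    (H.eq_fst s ht).trans (f.2 t ht)
  let G : C(unitInterval × (I^ Fin n), Path x₀ x₀) :=
    { toFun := fun q =>
        { toFun := fun s => H (q.1, (Fin.cons s q.2 : Fin (n + 1) → unitInterval))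
          continuous_toFun := hcont.comp (continuous_const.prodMk continuous_id)
          source' := hb _ _ ⟨0, Or.inl rfl⟩
          target' := hb _ _ ⟨0, Or.inr rfl⟩ }
      continuous_toFun :=
        continuous_induced_rng.2 (ContinuousMap.continuous_of_continuous_uncurry _ hcont) }
  obtain ⟨b, hb'⟩ := exists_d_eq_cubeElement_sub (y := Path.refl x₀) G (by
    rintro s t ⟨i, hi⟩
    ext r
    exact hb _ _ ⟨i.succ, by simpa using hi⟩)
  refine ⟨b, hb'.trans ?_⟩
  congr 2
  · ext t r
    exact H.apply_one _
  · ext t r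
    exact H.apply_zero _

/-- Coordinate `0` becomes the loop parameter, so concatenation in coordinate `1` survives the
adjunction as concatenation in the first cube coordinate. -/
lemma loopAdjoint_transAt (f g : Ω^ (Fin (n + 2)) X x₀) :
    loopAdjoint (GenLoop.transAt 1 f g) = GenLoop.transAt 0 (loopAdjoint f) (loopAdjoint g) := by
  ext t s
  change ite _ _ _ = (ite _ _ _ : Path x₀ x₀) s
  have key : ∀ c : unitInterval, Function.update (Fin.cons s t : Fin (n + 2) → unitInterval) 1 c =
      Fin.cons s (Function.update t 0 c) := fun c => 
    (Fin.cons_update (α := fun _ : Fin (n + 2) => unitInterval) s t 0 c).symm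
  have h1 : (Fin.cons s t : Fin (n + 2) → unitInterval) 1 = t 0 := rfl
  simp only [key, h1]
  split_ifs <;> rfl

/-- The Hurewicz class of the adjoint of a generalized loop. -/
lemma exists_isClassOf_loopAdjoint (g : Ω^ (Fin (n + 2)) X x₀) :
    ∃ z, IsClassOf (SingularComplex (Path x₀ x₀)) (cubeElement (loopAdjoint g).1) z :=
  IsClassOf.exists_of_d_eq_zero _ (d_cubeElement_genLoop _)

/-- The Hurewicz map `π_{n+1}(X) → H_n(ΩX; ℚ)`. -/
def hurewiczMap (x₀ : X) (n : ℕ) (a : HomotopyGroup (Fin (n + 2)) X x₀) :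
    RatHomology (Path x₀ x₀) (n + 1) :=
  Quotient.lift (fun g => (exists_isClassOf_loopAdjoint g).choose) (by
    intro f g h
    obtain ⟨b, hb⟩ := exists_d_eq_cubeElement_of_homotopic h
    refine IsClassOf.unique (K := SingularComplex (Path x₀ x₀)) ?_
      (exists_isClassOf_loopAdjoint g).choose_spec
    have := (exists_isClassOf_loopAdjoint f).choose_spec.add (IsClassOf.boundary b)
    rw [hb, add_zero] at this
    convert! this using 1
    abel) a

lemma hurewiczMap_spec (g : Ω^ (Fin (n + 2)) X x₀) :
    IsClassOf (SingularComplex (Path x₀ x₀)) (cubeElement (loopAdjoint g).1)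
      (hurewiczMap x₀ n (Quotient.mk _ g)) :=
  (exists_isClassOf_loopAdjoint g).choose_spec

lemma hurewiczMap_mul (a b : HomotopyGroup (Fin (n + 2)) X x₀) :
    hurewiczMap x₀ n (a * b) = hurewiczMap x₀ n a + hurewiczMap x₀ n b := by
  induction a using Quotient.inductionOn with | _ f
  induction b using Quotient.inductionOn with | _ g
  -- The product may be computed in any coordinate; coordinate `1` is compatible with the
  -- adjunction. The two factors appear in reverse order, which is harmless in homology.
  have hm := HomotopyGroup.mul_spec (i := (1 : Fin (n + 2))) (p := f) (q := g)
  refine (congrArg (hurewiczMap x₀ n) hm).trans ?_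
  refine IsClassOf.unique (K := SingularComplex (Path x₀ x₀)) (hurewiczMap_spec _) ?_
  rw [loopAdjoint_transAt]
  obtain ⟨b, hb⟩ := exists_d_eq_cubeElement_transAt (loopAdjoint g) (loopAdjoint f)
  obtain ⟨c, hc⟩ := exists_d_eq_cubeElement_const (n := n) (Path.refl x₀)
  -- The boundary of `c` cancels the constant cube left over in the boundary of `b`.
  have := ((hurewiczMap_spec f).add (hurewiczMap_spec g)).add
    ((IsClassOf.boundary (b + c)).smul (-1))
  rw [map_add, hb, hc, smul_zero, add_zero] at this
  refine Eq.mp (congrArg (fun x => IsClassOf (SingularComplex (Path x₀ x₀)) x _) ?_) this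
  module

/-- The Hurewicz map as an additive homomorphism. -/
def hurewiczHom (x₀ : X) (n : ℕ) :
    Additive (π_ (n + 1 + 1) X x₀) →+ RatHomology (Path x₀ x₀) (n + 1) :=
  AddMonoidHom.mk' (fun a => hurewiczMap x₀ n a.toMul) fun a b => hurewiczMap_mul a.toMul b.toMul

/-- The rational Hurewicz map. -/
def ratHurewicz (x₀ : X) (n : ℕ) :
    RatHomotopy x₀ (n + 1) →ₗ[ℚ] RatHomology (Path x₀ x₀) (n + 1) :=
  TensorProduct.AlgebraTensorModule.lift
    { toFun := fun q =>
        { toFun := fun a => q • hurewiczHom x₀ n a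
          map_add' := fun a b => by rw [map_add, smul_add]
          map_smul' := fun m a => by
            rw [map_zsmul, RingHom.id_apply, smul_comm] }
      map_add' := fun q r => by ext a; exact add_smul _ _ _
      map_smul' := fun q r => by ext a; exact mul_smul _ _ _ }

lemma ratHurewicz_tmul (q : ℚ) (a : Additive (π_ (n + 1 + 1) X x₀)) :
    ratHurewicz x₀ n (q ⊗ₜ[ℤ] a) = q • hurewiczHom x₀ n a := rfl

lemma represents_iff {Z : Chain Y n} {z : RatHomology Y n} :
    Z.Represents z ↔ IsClassOf (SingularComplex Y) Z.toComplex z := Iff.rfl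

/-- `IsHurewiczImage` only fixes `m • z` for one choice of `m` and `g`. Since homology is a rational
vector space, this forces `z = ratHurewicz x₀ n α`, and linearity then covers every other
representative. -/
theorem represents_hurewiczChain [NeZero n] {α : RatHomotopy x₀ n}
    {z : RatHomology (Path x₀ x₀) n} (hz : IsHurewiczImage α z) {k : ℚ}
    {g : Ω^ (Fin (n + 1)) X x₀} (hg : (1 : ℚ) ⊗ₜ[ℤ] homotopyClass g = k • α) :
    (hurewiczChain (loopAdjoint g)).Represents (k • z) := by
  obtain ⟨n, rfl⟩ := Nat.exists_eq_succ_of_ne_zero (NeZero.ne n)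
  have hspec : ∀ g : Ω^ (Fin (n + 1 + 1)) X x₀, (hurewiczChain (loopAdjoint g)).Represents
      (ratHurewicz x₀ n ((1 : ℚ) ⊗ₜ[ℤ] homotopyClass g)) := by
    intro g
    rw [represents_iff, toComplex_hurewiczChain, ratHurewicz_tmul, one_smul]
    exact hurewiczMap_spec g
  obtain ⟨m, g', hm, hα, hrep⟩ := hz
  have h1 := hspec g'
  rw [← hα, map_smul] at h1
  have h2 : (m : ℚ) • z = (m : ℚ) • ratHurewicz x₀ n α :=
    IsClassOf.unique (K := SingularComplex (Path x₀ x₀)) hrep h1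
  have hz : z = ratHurewicz x₀ n α := by
    have := congrArg (fun w => (m : ℚ)⁻¹ • w) h2
    simpa [smul_smul, inv_mul_cancel₀ (Nat.cast_ne_zero.2 hm : (m : ℚ) ≠ 0)] using this
  have h3 := hspec g
  rwa [hg, map_smul, ← hz] at h3

lemma represents_zero (Y : Type u) [TopologicalSpace Y] (n : ℕ) :
    (0 : Chain Y n).Represents (0 : RatHomology Y n) :=
  ⟨0, by simp [Chain.toComplex], map_zero _⟩

end Hurewicz

end LoopDistortion
end

noncomputable section

namespace LoopDistortion

/-! ### Collars on the cube; free and based homotopy -/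

section CubePadding

variable {m : ℕ}

/-- The distance to the centre of the cube, normalised to be `1` on the boundary. -/
def cubeRadius (v : Fin m → ℝ) : ℝ := ‖fun i => 2 * v i - 1‖

lemma continuous_cubeRadius : Continuous (cubeRadius (m := m)) := by
  unfold cubeRadius
  fun_prop

/-- The underlying real vector of a point of the cube. -/
def cubeCoe (t : I^ Fin m) : Fin m → ℝ := fun i => t i

lemma continuous_cubeCoe : Continuous (cubeCoe (m := m)) := by
  unfold cubeCoe
  fun_prop

/-- Expansion of the cube about its centre by the factor `c`, followed by clamping. -/
def cubeExpand (c : ℝ) (v : Fin m → ℝ) : I^ Fin m :=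
  fun i => Set.projIcc 0 1 zero_le_one (1 / 2 + c * (v i - 1 / 2))

lemma continuous_cubeExpand :
    Continuous fun q : ℝ × (Fin m → ℝ) => cubeExpand q.1 q.2 := by
  unfold cubeExpand
  refine continuous_pi fun i => continuous_projIcc.comp ?_
  fun_prop

lemma cubeExpand_one (t : I^ Fin m) : cubeExpand 1 (cubeCoe t) = t := by
  ext i
  have : 1 / 2 + 1 * ((t i : ℝ) - 1 / 2) = t i := by ring
  simp only [cubeExpand, cubeCoe, this, Set.projIcc_val]

/-- A coordinate realising the sup norm is pushed to a face or beyond it, and clamping returns it to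
that face. -/
lemma cubeExpand_mem_boundary [NeZero m] {c : ℝ} {v : Fin m → ℝ} (h : 1 ≤ c * cubeRadius v) :
    cubeExpand c v ∈ Cube.boundary (Fin m) := by
  obtain ⟨i, hi⟩ : ∃ i, cubeRadius v = abs (2 * v i - 1) := by
    obtain ⟨i, -, hi⟩ := Finset.exists_max_image Finset.univ (fun i => abs (2 * v i - 1))
      ⟨0, Finset.mem_univ _⟩
    refine ⟨i, le_antisymm ?_ ?_⟩
    · exact (pi_norm_le_iff_of_nonneg (abs_nonneg _)).2 fun j => hi j (Finset.mem_univ j)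
    · exact norm_le_pi_norm (fun i => 2 * v i - 1) i
  refine ⟨i, ?_⟩
  rw [hi] at h
  rcases le_total 0 (2 * v i - 1) with h0 | h0
  · right
    rw [abs_of_nonneg h0] at h
    exact Set.projIcc_of_right_le _ (by linarith)
  · left
    rw [abs_of_nonpos h0] at h
    exact Set.projIcc_of_le_left _ (by linarith)

lemma cubeRadius_of_mem_boundary {t : I^ Fin m} (h : t ∈ Cube.boundary (Fin m)) :
    cubeRadius (cubeCoe t) = 1 := by
  refine le_antisymm ((pi_norm_le_iff_of_nonneg zero_le_one).2 fun j => ?_) ?_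
  · have := (t j).2
    rw [Real.norm_eq_abs, abs_le]
    simp only [cubeCoe]
    constructor <;> linarith [this.1, this.2]
  · obtain ⟨i, hi⟩ := h
    refine le_trans ?_ (norm_le_pi_norm _ i)
    rcases hi with hi | hi <;> simp [cubeCoe, hi]
    norm_num

variable {X : Type u}

/-- The map `F`, shrunk to the inner half of the cube, surrounded by a collar in which the
radial coordinate runs along `β`. -/
def cubePad (F : (I^ Fin m) → X) (β : ℝ → X) (v : Fin m → ℝ) : X :=
  if cubeRadius v ≤ 1 / 2 then F (cubeExpand 2 v) else β (2 * cubeRadius v - 1)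

lemma cubePad_of_half_le [NeZero m] {F : (I^ Fin m) → X} {β : ℝ → X}
    (h : ∀ t ∈ Cube.boundary (Fin m), F t = β 0) {v : Fin m → ℝ} (hv : 1 / 2 ≤ cubeRadius v) :
    cubePad F β v = β (2 * cubeRadius v - 1) := by
  unfold cubePad
  split_ifs with h1
  · have h2 : cubeRadius v = 1 / 2 := le_antisymm h1 hv
    rw [h _ (cubeExpand_mem_boundary (by rw [h2]; norm_num)), h2]
    norm_num
  · rfl

lemma cubePad_boundary {F : (I^ Fin m) → X} {β : ℝ → X} {t : I^ Fin m}
    (ht : t ∈ Cube.boundary (Fin m)) : cubePad F β (cubeCoe t) = β 1 := by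
  unfold cubePad
  rw [cubeRadius_of_mem_boundary ht]
  norm_num

lemma cubePad_const [NeZero m] {F : (I^ Fin m) → X} {x : X}
    (h : ∀ t ∈ Cube.boundary (Fin m), F t = x) (v : Fin m → ℝ) :
    cubePad F (fun _ => x) v = F (cubeExpand 2 v) := by
  unfold cubePad
  split_ifs with h1
  · rfl
  · exact (h _ (cubeExpand_mem_boundary (by linarith))).symm

variable [TopologicalSpace X]

lemma continuous_cubePad [NeZero m] {S : Type*} [TopologicalSpace S] {F : S → (I^ Fin m) → X}
    {β : S → ℝ → X} (hF : Continuous fun q : S × (I^ Fin m) => F q.1 q.2)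
    (hβ : Continuous fun q : S × ℝ => β q.1 q.2)
    (h : ∀ s, ∀ t ∈ Cube.boundary (Fin m), F s t = β s 0) :
    Continuous fun q : S × (Fin m → ℝ) => cubePad (F q.1) (β q.1) q.2 := by
  have hr : Continuous fun q : S × (Fin m → ℝ) => cubeRadius q.2 :=
    continuous_cubeRadius.comp continuous_snd
  refine Continuous.if_le ?_ ?_ hr continuous_const ?_
  · exact hF.comp (continuous_fst.prodMk
      (continuous_cubeExpand.comp (continuous_const.prodMk continuous_snd)))
  · exact hβ.comp (continuous_fst.prodMk (by fun_prop))
  · intro q hq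
    rw [h _ _ (cubeExpand_mem_boundary (by rw [hq]; norm_num)), hq]
    norm_num

/-- The predicate "constant on the boundary of the cube". -/
def BoundaryConst (f : C(I^ Fin m, X)) : Prop :=
  ∀ t ∈ Cube.boundary (Fin m), ∀ t' ∈ Cube.boundary (Fin m), f t = f t'

lemma one_le_expand {t : I^ Fin m} (ht : t ∈ Cube.boundary (Fin m)) (s : unitInterval) :
    1 ≤ (1 + (s : ℝ)) * cubeRadius (cubeCoe t) := by
  rw [cubeRadius_of_mem_boundary ht]
  linarith [s.2.1]

/-- The expansion homotopy of a map of the cube. -/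
def expandHomotopy (F : C(I^ Fin m, X)) : C(unitInterval × (I^ Fin m), X) :=
  ⟨fun q => F (cubeExpand (1 + (q.1 : ℝ)) (cubeCoe q.2)), F.continuous.comp
    (continuous_cubeExpand.comp ((by fun_prop : Continuous fun q : unitInterval × (I^ Fin m) =>
      1 + (q.1 : ℝ)).prodMk (continuous_cubeCoe.comp continuous_snd)))⟩

lemma expandHomotopy_zero (F : C(I^ Fin m, X)) (t : I^ Fin m) : expandHomotopy F (0, t) = F t := by
  simp [expandHomotopy, cubeExpand_one]

lemma expandHomotopy_one (F : C(I^ Fin m, X)) (t : I^ Fin m) :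
    expandHomotopy F (1, t) = F (cubeExpand 2 (cubeCoe t)) := by
  simp [expandHomotopy, one_add_one_eq_two]

/-- A map which is constant on the boundary is homotopic, through such maps, to its padding by a
path. -/
lemma homotopicWith_cubePad [NeZero m] (F : C(I^ Fin m, X)) (β : ℝ → X) (hβ : Continuous β)
    (h : ∀ t ∈ Cube.boundary (Fin m), F t = β 0) (G : C(I^ Fin m, X))
    (hG : ∀ t, G t = cubePad F β (cubeCoe t)) : F.HomotopicWith G BoundaryConst := by
  have hc : Continuous fun t : I^ Fin m => F (cubeExpand 2 (cubeCoe t)) :=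
    F.continuous.comp (continuous_cubeExpand.comp (continuous_const.prodMk continuous_cubeCoe))
  have h1 : F.HomotopicWith (⟨_, hc⟩ : C(I^ Fin m, X)) BoundaryConst :=
    ⟨{ toContinuousMap := expandHomotopy F
       map_zero_left := expandHomotopy_zero F
       map_one_left := expandHomotopy_one F
       prop' := fun s t ht t' ht' =>
        (h _ (cubeExpand_mem_boundary (one_le_expand ht s))).trans
          (h _ (cubeExpand_mem_boundary (one_le_expand ht' s))).symm }⟩
  have hpad : Continuous fun q : unitInterval × (Fin m → ℝ) =>
      cubePad F (fun r => β (q.1 * r)) q.2 :=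
    continuous_cubePad (F := fun _ => F) (β := fun (s : unitInterval) r => β (s * r))
      (F.continuous.comp continuous_snd) (hβ.comp (by fun_prop)) (fun s t ht => by
        rw [mul_zero]; exact h t ht)
  refine h1.trans ⟨{
    toFun := fun q => cubePad F (fun r => β (q.1 * r)) (cubeCoe q.2)
    continuous_toFun := hpad.comp (continuous_fst.prodMk (continuous_cubeCoe.comp continuous_snd))
    map_zero_left := fun t => ?_
    map_one_left := fun t => ?_
    prop' := fun s t ht t' ht' => ?_ }⟩
  · simp only [Set.Icc.coe_zero, zero_mul]
    exact cubePad_const h _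
  · simp only [Set.Icc.coe_one, one_mul, hG]
  · change cubePad F (fun r => β (s * r)) (cubeCoe t) = cubePad F (fun r => β (s * r)) (cubeCoe t')
    rw [cubePad_boundary ht, cubePad_boundary ht']

lemma homotopicWith_const [PathConnectedSpace X] (x x' : X) :
    (ContinuousMap.const (I^ Fin m) x).HomotopicWith (ContinuousMap.const (I^ Fin m) x')
      BoundaryConst := by
  obtain ⟨β⟩ := PathConnectedSpace.joined x x'
  exact ⟨{ toFun := fun q => β q.1
           continuous_toFun := by fun_prop
           map_zero_left := fun _ => β.source
           map_one_left := fun _ => β.target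
           prop' := fun s t _ t' _ => rfl }⟩

variable {x₀ : X}

/-- A generalized loop expanded to be constant near the boundary. -/
def expandLoop [NeZero m] (g : Ω^ (Fin m) X x₀) : Ω^ (Fin m) X x₀ :=
  ⟨⟨fun t => g (cubeExpand 2 (cubeCoe t)), g.1.continuous.comp (continuous_cubeExpand.comp
    (continuous_const.prodMk continuous_cubeCoe))⟩, fun t ht => g.2 _ (cubeExpand_mem_boundary
      (by rw [cubeRadius_of_mem_boundary ht]; norm_num))⟩

lemma homotopic_expandLoop [NeZero m] (g : Ω^ (Fin m) X x₀) :
    GenLoop.Homotopic g (expandLoop g) :=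
  ⟨{ toContinuousMap := expandHomotopy g.1
     map_zero_left := expandHomotopy_zero g.1
     map_one_left := expandHomotopy_one g.1
     prop' := fun s t ht => (g.2 _ (cubeExpand_mem_boundary (one_le_expand ht s))).trans
      (g.2 t ht).symm }⟩

/-- In a simply connected space, freely homotopic generalized loops are homotopic. -/
theorem genLoop_homotopic_of_homotopicWith [SimplyConnectedSpace X] [NeZero m]
    {g g' : Ω^ (Fin m) X x₀} (h : g.1.HomotopicWith g'.1 BoundaryConst) :
    GenLoop.Homotopic g g' := by
  obtain ⟨H⟩ := h
  have hb : (0 : I^ Fin m) ∈ Cube.boundary (Fin m) := ⟨0, Or.inl rfl⟩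
  let c : Path x₀ x₀ :=
    { toFun := fun s => H (s, 0)
      continuous_toFun := by fun_prop
      source' := (H.apply_zero _).trans (g.2 _ hb)
      target' := (H.apply_one _).trans (g'.2 _ hb) }
  obtain ⟨K⟩ : c.Homotopic (Path.refl x₀) := SimplyConnectedSpace.paths_homotopic c _
  -- The boundary traces the loop `c` during the free homotopy. At time `s`, the collar follows the
  -- contraction of `c` from `c s` to `x₀`; at both end times it is constant, leaving just the
  -- expanded loops.
  let κ : unitInterval → ℝ → X := fun s r => K (Set.projIcc 0 1 zero_le_one r, s)
  have hκ : Continuous fun q : unitInterval × ℝ => κ q.1 q.2 :=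
    K.continuous.comp ((continuous_projIcc.comp continuous_snd).prodMk continuous_fst)
  have hpad := continuous_cubePad (F := fun (s : unitInterval) (t : I^ Fin m) => H (s, t)) (β := κ)
    H.continuous hκ (fun s t ht => by
      refine (H.prop s t ht 0 hb).trans ?_
      simp only [κ, Set.projIcc_left]
      exact (K.apply_zero s).symm)
  have hκ0 : ∀ r, κ 0 r = x₀ := fun r => K.source _
  have hκ1 : ∀ r, κ 1 r = x₀ := fun r => K.target _
  have key : GenLoop.Homotopic (expandLoop g) (expandLoop g') := by
    refine ⟨{
      toFun := fun q => cubePad (fun t => H (q.1, t)) (κ q.1) (cubeCoe q.2)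
      continuous_toFun :=
        hpad.comp (continuous_fst.prodMk (continuous_cubeCoe.comp continuous_snd))
      map_zero_left := fun t => ?_
      map_one_left := fun t => ?_
      prop' := fun s t ht => ?_ }⟩
    · simp only [H.apply_zero]
      rw [show κ 0 = fun _ => x₀ from funext hκ0]
      exact cubePad_const g.2 _
    · simp only [H.apply_one]
      rw [show κ 1 = fun _ => x₀ from funext hκ1]
      exact cubePad_const g'.2 _
    · change cubePad (fun t => H (s, t)) (κ s) (cubeCoe t) = (expandLoop g).1 t
      rw [cubePad_boundary ht, (expandLoop g).2 t ht]
      simp only [κ, Set.projIcc_right]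
      exact K.apply_one s
  exact (homotopic_expandLoop g).trans (key.trans (homotopic_expandLoop g').symm)

end CubePadding

end LoopDistortion
end

noncomputable section

namespace LoopDistortion

/-! ### Lipschitz estimates from the Riemannian metric -/

section Riemannian

open Set Filter MeasureTheory Manifold
open scoped NNReal

attribute [local instance] normedAddCommGroupTangentSpaceVectorSpace
attribute [local instance] normedSpaceTangentSpaceVectorSpace

variable {E : Type*} [NormedAddCommGroup E] [NormedSpace ℝ E] {H : Type*} [TopologicalSpace H]
  {J : ModelWithCorners ℝ E H} [J.Boundaryless] {X : Type*} [MetricSpace X] [ChartedSpace H X]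
  [IsManifold J 1 X] [Bundle.RiemannianBundle (fun x : X => TangentSpace J x)]
  [IsContinuousRiemannianBundle E (fun x : X => TangentSpace J x)]
  [IsRiemannianManifold J X]

variable (J) in
omit [IsRiemannianManifold J X] in
/-- The derivative of the inverse of a chart is locally bounded. -/
lemma eventually_enorm_mfderiv_extChartAt_symm_le (x : X) :
    ∃ C : ℝ≥0, ∀ᶠ y in 𝓝 (extChartAt J x x), ∀ v : E,
      ‖(mfderiv 𝓘(ℝ, E) J (extChartAt J x).symm y v : TangentSpace J ((extChartAt J x).symm y))‖ₑ ≤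
        C * ‖v‖ₑ := by
  rcases eventually_enorm_mfderivWithin_symm_extChartAt_lt J x with ⟨C, -, hC⟩
  rw [ModelWithCorners.range_eq_univ, nhdsWithin_univ] at hC
  simp only [mfderivWithin_univ] at hC
  refine ⟨C, hC.mono fun y hy v => ?_⟩
  exact (ContinuousLinearMap.le_opENorm _ v).trans (mul_le_mul_left hy.le _)

variable (J) in
/-- The inverse of a chart is Lipschitz on a small ball. -/
lemma exists_lipschitzOnWith_extChartAt_symm (x : X) :
    ∃ A : ℝ≥0, ∃ r > 0, Metric.ball (extChartAt J x x) r ⊆ (extChartAt J x).target ∧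
      LipschitzOnWith A (extChartAt J x).symm (Metric.ball (extChartAt J x x) r) := by
  rcases eventually_enorm_mfderiv_extChartAt_symm_le J x with ⟨C, hC⟩
  obtain ⟨r, r_pos, hr⟩ := Metric.mem_nhds_iff.1 (inter_mem (extChartAt_target_mem_nhds x) hC)
  refine ⟨C, r, r_pos, fun y hy => (hr hy).1, ?_⟩
  intro a ha b hb
  rw [(inferInstance : IsRiemannianManifold J X).out]
  -- The image of the straight segment is a competitor for the Riemannian distance, and the
  -- derivative bound controls its length.
  let η := ContinuousAffineMap.lineMap (R := ℝ) a b
  set γ := (extChartAt J x).symm ∘ η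
  have hη : ∀ t ∈ Icc (0 : ℝ) 1, η t ∈ Metric.ball (extChartAt J x x) r := by
    intro t ht
    apply (convex_ball _ _).segment_subset ha hb
    rw [segment_eq_image_lineMap]
    exact ⟨t, ht, rfl⟩
  have η_smooth : ContMDiff 𝓘(ℝ, ℝ) 𝓘(ℝ, E) 1 η := by
    rw [contMDiff_iff_contDiff]
    exact ContinuousAffineMap.contDiff _
  have : riemannianEDist J ((extChartAt J x).symm a) ((extChartAt J x).symm b) ≤
      pathELength J γ 0 1 := by
    apply riemannianEDist_le_pathELength _ _ _ zero_le_one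
    · exact (contMDiffOn_extChartAt_symm x).comp η_smooth.contMDiffOn fun t ht => (hr (hη t ht)).1
    · simp [γ, η, ContinuousAffineMap.coe_lineMap_eq]
    · simp [γ, η, ContinuousAffineMap.coe_lineMap_eq]
  apply this.trans
  rw [← lintegral_fderiv_lineMap_eq_edist, pathELength_eq_lintegral_mfderivWithin_Icc,
    ← lintegral_const_mul' _ _ ENNReal.coe_ne_top]
  apply setLIntegral_mono' measurableSet_Icc (fun t ht ↦ ?_)
  have hcomp : mfderivWithin 𝓘(ℝ, ℝ) J γ (Icc 0 1) t =
      (mfderiv 𝓘(ℝ, E) J (extChartAt J x).symm (η t)) ∘L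
        (mfderivWithin 𝓘(ℝ, ℝ) 𝓘(ℝ, E) η (Icc 0 1) t) := by
    apply mfderiv_comp_mfderivWithin
    · have := mdifferentiableWithinAt_extChartAt_symm (hr (hη t ht)).1
      rwa [ModelWithCorners.range_eq_univ, mdifferentiableWithinAt_univ] at this
    · exact (η_smooth.mdifferentiable one_ne_zero).mdifferentiableOn t ht
    · rw [uniqueMDiffWithinAt_iff_uniqueDiffWithinAt]
      exact uniqueDiffOn_Icc zero_lt_one t ht
  have : mfderivWithin 𝓘(ℝ, ℝ) J γ (Icc 0 1) t 1 =
      (mfderiv 𝓘(ℝ, E) J (extChartAt J x).symm (η t))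
        (mfderivWithin 𝓘(ℝ, ℝ) 𝓘(ℝ, E) η (Icc 0 1) t 1) := congr($hcomp 1)
  rw [this]
  refine ((hr (hη t ht)).2 _).trans ?_
  rw [mfderivWithin_eq_fderivWithin]
  rfl

variable {F : Type*} [NormedAddCommGroup F] [NormedSpace ℝ F]

omit [IsRiemannianManifold J X] in
/-- The derivative of a `C¹` function is locally bounded. -/
lemma eventually_enorm_mfderiv_le {ψ : X → F} (hψ : ContMDiff J 𝓘(ℝ, F) 1 ψ) (x : X) :
    ∃ C : ℝ≥0, ∀ᶠ y in 𝓝 x, ∀ v : TangentSpace J y,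
      ‖(mfderiv J 𝓘(ℝ, F) ψ y v : F)‖ₑ ≤ C * ‖v‖ₑ := by
  rcases eventually_enorm_mfderiv_extChartAt_lt J x with ⟨C, -, hC⟩
  set φ := extChartAt J x with hφ
  have hopen : IsOpen φ.target := isOpen_extChartAt_target x
  have hh : ContDiffOn ℝ 1 (ψ ∘ φ.symm) φ.target := by
    rw [← contMDiffOn_iff_contDiffOn]
    exact hψ.comp_contMDiffOn (contMDiffOn_extChartAt_symm x)
  have hcont : ContinuousAt (fun e => ‖fderiv ℝ (ψ ∘ φ.symm) e‖ₑ) (φ x) :=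
    ((hh.continuousOn_fderiv_of_isOpen hopen le_rfl).continuousAt
      (hopen.mem_nhds (mem_extChartAt_target x))).enorm
  have hlt : ‖fderiv ℝ (ψ ∘ φ.symm) (φ x)‖ₑ < ((‖fderiv ℝ (ψ ∘ φ.symm) (φ x)‖₊ + 1 : ℝ≥0) : ℝ≥0∞) := by
    rw [enorm_eq_nnnorm]
    exact_mod_cast lt_add_one _
  have hev := (continuousAt_extChartAt x : ContinuousAt φ x).eventually (hcont.eventually_lt_const hlt)
  refine ⟨(‖fderiv ℝ (ψ ∘ φ.symm) (φ x)‖₊ + 1) * C, ?_⟩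
  filter_upwards [hC, hev,
    (extChartAt_source_mem_nhds x : φ.source ∈ 𝓝 x)] with y hy1 hy2 hy3 v
  have hyt : φ y ∈ φ.target := φ.map_source hy3
  have heq : ψ =ᶠ[𝓝 y] (ψ ∘ φ.symm) ∘ φ := by
    filter_upwards [(isOpen_extChartAt_source x).mem_nhds hy3] with w hw
    simp only [Function.comp_apply]
    rw [φ.left_inv hw]
  have hd : MDifferentiableAt 𝓘(ℝ, E) 𝓘(ℝ, F) (ψ ∘ φ.symm) (φ y) :=
    ((hh.contDiffAt (hopen.mem_nhds hyt)).differentiableAt (by simp)).mdifferentiableAt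
  have hφd : MDifferentiableAt J 𝓘(ℝ, E) φ y :=
    mdifferentiableAt_extChartAt (by rwa [← extChartAt_source J])
  have hval : (mfderiv J 𝓘(ℝ, F) ψ y v : F) =
      fderiv ℝ (ψ ∘ φ.symm) (φ y) (mfderiv J 𝓘(ℝ, E) φ y v) := by
    rw [heq.mfderiv_eq, mfderiv_comp y hd hφd, mfderiv_eq_fderiv]
    rfl
  rw [hval]
  refine (ContinuousLinearMap.le_opENorm _ _).trans ?_
  rw [ENNReal.coe_mul, mul_assoc]
  gcongr
  · exact hy2.le
  · refine (ContinuousLinearMap.le_opENorm _ _).trans ?_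
    gcongr
    exact hy1.le

/-- A `C¹` function on a compact Riemannian manifold is Lipschitz. -/
lemma exists_lipschitzWith_of_contMDiff [CompleteSpace F] [CompactSpace X] {ψ : X → F}
    (hψ : ContMDiff J 𝓘(ℝ, F) 1 ψ) : ∃ B : ℝ≥0, LipschitzWith B ψ := by
  obtain ⟨B, hB⟩ : ∃ B : ℝ≥0, ∀ y ∈ (univ : Set X), ∀ v : TangentSpace J y,
      ‖(mfderiv J 𝓘(ℝ, F) ψ y v : F)‖ₑ ≤ B * ‖v‖ₑ := by
    refine isCompact_univ.induction_on (p := fun s => ∃ B : ℝ≥0, ∀ y ∈ s,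
      ∀ v : TangentSpace J y, ‖(mfderiv J 𝓘(ℝ, F) ψ y v : F)‖ₑ ≤ B * ‖v‖ₑ) ?_ ?_ ?_ ?_
    · exact ⟨0, by simp⟩
    · rintro s t hst ⟨B, hB⟩
      exact ⟨B, fun y hy => hB y (hst hy)⟩
    · rintro s t ⟨B, hB⟩ ⟨B', hB'⟩
      refine ⟨max B B', ?_⟩
      rintro y (hy | hy) v
      · exact (hB y hy v).trans (by gcongr; exact le_max_left _ _)
      · exact (hB' y hy v).trans (by gcongr; exact le_max_right _ _)
    · intro x _
      obtain ⟨C, hC⟩ := eventually_enorm_mfderiv_le hψ x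
      exact ⟨_, mem_nhdsWithin_of_mem_nhds hC, C, fun y hy => hy⟩
  -- Adding `1` makes the constant nonzero, so that the strict inequality with `r` can be divided by
  -- it.
  refine ⟨B + 1, fun x y => ?_⟩
  rw [(inferInstance : IsRiemannianManifold J X).out]
  refine le_of_forall_gt fun r hr => ?_
  rw [mul_comm, ← ENNReal.lt_div_iff_mul_lt (Or.inl (by simp)) (Or.inl ENNReal.coe_ne_top)] at hr
  obtain ⟨γ, rfl, rfl, hγ, hlen⟩ := exists_lt_of_riemannianEDist_lt hr
  have hsmooth : ContMDiffOn 𝓘(ℝ, ℝ) 𝓘(ℝ, F) 1 (ψ ∘ γ) (Icc 0 1) :=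
    hψ.comp_contMDiffOn hγ
  calc edist (ψ (γ 0)) (ψ (γ 1)) = ‖(ψ ∘ γ) 1 - (ψ ∘ γ) 0‖ₑ := by
        rw [edist_comm, edist_eq_enorm_sub]; rfl
    _ ≤ ∫⁻ t in Icc 0 1, ‖derivWithin (ψ ∘ γ) (Icc 0 1) t‖ₑ := by
      apply enorm_sub_le_lintegral_derivWithin_Icc_of_contDiffOn_Icc _ zero_le_one
      rwa [← contMDiffOn_iff_contDiffOn]
    _ ≤ ∫⁻ t in Icc 0 1, (B + 1 : ℝ≥0) *
        ‖mfderivWithin 𝓘(ℝ, ℝ) J γ (Icc 0 1) t 1‖ₑ := by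
      refine setLIntegral_mono' measurableSet_Icc fun t ht => ?_
      have hcomp : mfderivWithin 𝓘(ℝ, ℝ) 𝓘(ℝ, F) (ψ ∘ γ) (Icc 0 1) t =
          (mfderiv J 𝓘(ℝ, F) ψ (γ t)) ∘L
            (mfderivWithin 𝓘(ℝ, ℝ) J γ (Icc 0 1) t) := by
        apply mfderiv_comp_mfderivWithin
        · exact hψ.mdifferentiable (by simp) _
        · exact hγ.mdifferentiableOn one_ne_zero t ht
        · rw [uniqueMDiffWithinAt_iff_uniqueDiffWithinAt]
          exact uniqueDiffOn_Icc zero_lt_one t ht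
      have h1 : derivWithin (ψ ∘ γ) (Icc 0 1) t = (mfderiv J 𝓘(ℝ, F) ψ (γ t)
          (mfderivWithin 𝓘(ℝ, ℝ) J γ (Icc 0 1) t 1) : F) := by
        rw [← fderivWithin_derivWithin, ← mfderivWithin_eq_fderivWithin]
        exact congr($hcomp 1)
      rw [h1]
      refine (hB _ (mem_univ _) _).trans ?_
      gcongr
      exact le_self_add
    _ = (B + 1 : ℝ≥0) * pathELength J γ 0 1 := by
      rw [lintegral_const_mul' _ _ ENNReal.coe_ne_top, pathELength_eq_lintegral_mfderivWithin_Icc]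
    _ < r := by
      rw [mul_comm]
      exact (ENNReal.lt_div_iff_mul_lt (Or.inl (by simp)) (Or.inl ENNReal.coe_ne_top)).1 hlen

section LocalLipschitz

variable {V : Type*} [NormedAddCommGroup V] [NormedSpace ℝ V] {M : Type*} [PseudoMetricSpace M]

/-- A map on a normed space which is pointwise locally `K`-Lipschitz is `K`-Lipschitz. -/
lemma lipschitzWith_of_eventually_dist_le {f : V → M} {K : ℝ≥0}
    (h : ∀ x, ∀ᶠ y in 𝓝 x, dist (f y) (f x) ≤ K * dist y x) : LipschitzWith K f := by
  have hcont : Continuous f := by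
    rw [continuous_iff_continuousAt]
    intro x
    refine tendsto_iff_dist_tendsto_zero.2 (squeeze_zero' (Eventually.of_forall fun _ => dist_nonneg)
      (h x) ?_)
    have : Tendsto (fun y => K * dist y x) (𝓝 x) (𝓝 (K * dist x x)) :=
      (by fun_prop : Continuous fun y => K * dist y x).tendsto x
    simpa using this
  refine LipschitzWith.of_dist_le_mul fun b a => ?_
  let γ : ℝ → V := fun t => a + t • (b - a)
  have hγ : Continuous γ := by fun_prop
  have hγd : ∀ s t, dist (γ s) (γ t) = abs (s - t) * dist b a := by
    intro s t
    simp only [γ, dist_eq_norm]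
    rw [← Real.norm_eq_abs, ← norm_smul]
    congr 1
    module
  let S : Set ℝ := {t | dist (f (γ t)) (f a) ≤ K * (t * dist b a)}
  have hS : IsClosed S := isClosed_le (by fun_prop) (by fun_prop)
  -- Continuous induction along the segment: `S` is closed, and the local estimate at `γ t` extends
  -- it to the right of `t`.
  have hsub : Icc (0 : ℝ) 1 ⊆ S := by
    refine (hS.inter isClosed_Icc).Icc_subset_of_forall_mem_nhdsWithin ?_ ?_
    · simp [S, γ]
    · rintro t ⟨ht, -⟩
      have h1 := (hγ.tendsto t).eventually (h (γ t))
      filter_upwards [mem_nhdsWithin_of_mem_nhds h1, self_mem_nhdsWithin] with s hs hst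
      rw [hγd, abs_of_pos (sub_pos.2 hst)] at hs
      have h2 : dist (f (γ t)) (f a) ≤ K * (t * dist b a) := ht
      change dist (f (γ s)) (f a) ≤ K * (s * dist b a)
      linarith [dist_triangle (f (γ s)) (f (γ t)) (f a)]
  have h1 := hsub (right_mem_Icc.2 zero_le_one)
  simpa [S, γ] using h1

/-- Lipschitz maps on the two sides of a hypersurface glue. -/
lemma lipschitzWith_of_le_of_ge {f : V → M} {K : ℝ≥0} {r : V → ℝ} (hr : Continuous r) {c : ℝ}
    (h1 : LipschitzOnWith K f {v | r v ≤ c}) (h2 : LipschitzOnWith K f {v | c ≤ r v}) :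
    LipschitzWith K f := by
  refine lipschitzWith_of_eventually_dist_le fun x => ?_
  rcases lt_trichotomy (r x) c with hx | hx | hx
  · filter_upwards [hr.continuousAt.eventually_lt_const hx] with y hy
    exact h1.dist_le_mul y hy.le x hx.le
  · refine Eventually.of_forall fun y => ?_
    rcases le_total (r y) c with hy | hy
    · exact h1.dist_le_mul y hy x hx.le
    · exact h2.dist_le_mul y hy x hx.ge
  · filter_upwards [hr.continuousAt.eventually_const_lt hx] with y hy
    exact h2.dist_le_mul y hy.le x hx.le

end LocalLipschitz

/-! ### Lipschitz paths to the base point -/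

section LipschitzPaths

/-- The points `x` and `y` are joined by a `K`-Lipschitz path, parametrised by the real line. -/
def LipJoined {M : Type*} [PseudoMetricSpace M] (K : ℝ≥0) (x y : M) : Prop :=
  ∃ β : ℝ → M, LipschitzWith K β ∧ β 0 = x ∧ β 1 = y

variable {M : Type*} [PseudoMetricSpace M]

lemma LipJoined.symm {K : ℝ≥0} {x y : M} (h : LipJoined K x y) : LipJoined K y x := by
  obtain ⟨β, hβ, rfl, rfl⟩ := h
  refine ⟨fun t => β (1 - t), LipschitzWith.of_dist_le_mul fun s t => ?_, by simp, by simp⟩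
  refine (hβ.dist_le_mul _ _).trans_eq ?_
  rw [dist_sub_left]

lemma LipJoined.trans {K K' : ℝ≥0} {x y z : M} (h : LipJoined K x y) (h' : LipJoined K' y z) :
    LipJoined (2 * max K K') x z := by
  obtain ⟨β, hβ, rfl, rfl⟩ := h
  obtain ⟨β', hβ', h0, rfl⟩ := h'
  refine ⟨fun t => if t ≤ 1 / 2 then β (2 * t) else β' (2 * t - 1), ?_, by norm_num, by norm_num⟩
  refine lipschitzWith_of_le_of_ge (r := id) continuous_id (c := 1 / 2) ?_ ?_
  · refine LipschitzOnWith.of_dist_le_mul fun s hs t ht => ?_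
    simp only [id, mem_ofPred_eq] at hs ht
    rw [if_pos hs, if_pos ht]
    refine (hβ.dist_le_mul _ _).trans ?_
    rw [Real.dist_eq, ← mul_sub, abs_mul, ← Real.dist_eq, abs_two, NNReal.coe_mul]
    have : (K : ℝ) ≤ (max K K' : ℝ≥0) := by exact_mod_cast le_max_left K K'
    push_cast at this ⊢
    nlinarith [dist_nonneg (x := s) (y := t)]
  · have key : ∀ s : ℝ, 1 / 2 ≤ s → (if s ≤ 1 / 2 then β (2 * s) else β' (2 * s - 1)) =
        β' (2 * s - 1) := by
      intro s hs
      split_ifs with h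
      · rw [le_antisymm h hs]
        norm_num [h0]
      · rfl
    refine LipschitzOnWith.of_dist_le_mul fun s hs t ht => ?_
    rw [key s hs, key t ht]
    refine (hβ'.dist_le_mul _ _).trans ?_
    rw [Real.dist_eq, sub_sub_sub_cancel_right, ← mul_sub, abs_mul, ← Real.dist_eq, abs_two,
      NNReal.coe_mul]
    have : (K' : ℝ) ≤ (max K K' : ℝ≥0) := by exact_mod_cast le_max_right K K'
    push_cast at this ⊢
    nlinarith [dist_nonneg (x := s) (y := t)]

/-- The path is a straight segment in a chart ball of radius `r`, carried back by the `A`-Lipschitz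
inverse. The constant `A * r` therefore does not depend on the nearby point; `projIcc` freezes the
path outside the unit interval. -/
lemma eventually_lipJoined {E : Type*} [NormedAddCommGroup E] [NormedSpace ℝ E] {H : Type*}
    [TopologicalSpace H] (J : ModelWithCorners ℝ E H) [J.Boundaryless] {X : Type*} [MetricSpace X]
    [ChartedSpace H X] [IsManifold J 1 X]
    [Bundle.RiemannianBundle (fun x : X => TangentSpace J x)]
    [IsContinuousRiemannianBundle E (fun x : X => TangentSpace J x)]
    [IsRiemannianManifold J X] (x : X) : ∃ K : ℝ≥0, ∀ᶠ y in 𝓝 x, LipJoined K y x := by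
  obtain ⟨A, r, hr, hsub, hA⟩ := exists_lipschitzOnWith_extChartAt_symm J x
  refine ⟨A * r.toNNReal, ?_⟩
  have h1 : ∀ᶠ y in 𝓝 x, extChartAt J x y ∈ Metric.ball (extChartAt J x x) r :=
    (continuousAt_extChartAt x).eventually (Metric.ball_mem_nhds _ hr)
  filter_upwards [h1, (extChartAt_source_mem_nhds x : (extChartAt J x).source ∈ 𝓝 x)] with y hy hys
  have hmem : ∀ t : ℝ, AffineMap.lineMap (k := ℝ) (extChartAt J x y) (extChartAt J x x)
      (projIcc 0 1 zero_le_one t : ℝ) ∈ Metric.ball (extChartAt J x x) r := by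
    intro t
    apply (convex_ball _ _).segment_subset hy (Metric.mem_ball_self hr)
    rw [segment_eq_image_lineMap]
    exact ⟨_, (projIcc 0 1 zero_le_one t).2, rfl⟩
  refine ⟨fun t => (extChartAt J x).symm (AffineMap.lineMap (k := ℝ) (extChartAt J x y)
    (extChartAt J x x) (projIcc 0 1 zero_le_one t : ℝ)), ?_, ?_, ?_⟩
  · refine LipschitzWith.of_dist_le_mul fun s t => ?_
    refine (hA.dist_le_mul _ (hmem s) _ (hmem t)).trans ?_
    rw [dist_lineMap_lineMap, NNReal.coe_mul, Real.coe_toNNReal _ hr.le, mul_assoc]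
    have h2 : dist (projIcc (0 : ℝ) 1 zero_le_one s : ℝ) (projIcc 0 1 zero_le_one t) ≤ dist s t := by
      have := (LipschitzWith.projIcc (zero_le_one (α := ℝ))).dist_le_mul s t
      rwa [NNReal.coe_one, one_mul] at this
    have h3 : dist (extChartAt J x y) (extChartAt J x x) ≤ r := (Metric.mem_ball.1 hy).le
    rw [mul_comm r]
    gcongr
  · simp only [projIcc_left, AffineMap.lineMap_apply_zero]
    exact (extChartAt J x).left_inv hys
  · simp

/-- In a compact connected Riemannian manifold all points are joined to a base point by paths with
a common Lipschitz constant. -/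
lemma exists_lipJoined {E : Type*} [NormedAddCommGroup E] [NormedSpace ℝ E] {H : Type*}
    [TopologicalSpace H] (J : ModelWithCorners ℝ E H) [J.Boundaryless] {X : Type*} [MetricSpace X]
    [ChartedSpace H X] [IsManifold J 1 X]
    [Bundle.RiemannianBundle (fun x : X => TangentSpace J x)]
    [IsContinuousRiemannianBundle E (fun x : X => TangentSpace J x)]
    [IsRiemannianManifold J X] [CompactSpace X] [PreconnectedSpace X] (x₀ : X) :
    ∃ K : ℝ≥0, ∀ y, LipJoined K y x₀ := by
  have hall : ∀ y, ∃ K : ℝ≥0, LipJoined K y x₀ := by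
    intro y
    -- Being joined is a transitive relation that holds locally in both directions, so connectedness
    -- makes it hold everywhere. Compactness then gives a common constant.
    refine PreconnectedSpace.induction₂' (fun a b : X => ∃ K : ℝ≥0, LipJoined K a b) ?_ ⟨?_⟩ y x₀
    · intro x
      obtain ⟨K, hK⟩ := eventually_lipJoined J x
      exact hK.mono fun y hy => ⟨⟨K, hy.symm⟩, K, hy⟩
    · rintro a b c ⟨K, h⟩ ⟨K', h'⟩
      exact ⟨_, h.trans h'⟩
  have hmono : ∀ {K K' : ℝ≥0} {a b : X}, K ≤ K' → LipJoined K a b → LipJoined K' a b := by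
    rintro K K' a b hK ⟨β, hβ, h⟩
    exact ⟨β, hβ.weaken hK, h⟩
  obtain ⟨K, hK⟩ : ∃ K : ℝ≥0, ∀ y ∈ (univ : Set X), LipJoined K y x₀ := by
    refine isCompact_univ.induction_on (p := fun s => ∃ K : ℝ≥0, ∀ y ∈ s, LipJoined K y x₀)
      ⟨0, by simp⟩ ?_ ?_ ?_
    · rintro s t hst ⟨K, hK⟩
      exact ⟨K, fun y hy => hK y (hst hy)⟩
    · rintro s t ⟨K, hK⟩ ⟨K', hK'⟩
      refine ⟨max K K', ?_⟩
      rintro y (hy | hy)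
      · exact hmono (le_max_left _ _) (hK y hy)
      · exact hmono (le_max_right _ _) (hK' y hy)
    · intro x _
      obtain ⟨K, hK⟩ := eventually_lipJoined J x
      obtain ⟨K', hK'⟩ := hall x
      exact ⟨_, mem_nhdsWithin_of_mem_nhds hK, _, fun y hy => LipJoined.trans hy hK'⟩
  exact ⟨K, fun y => hK y (mem_univ y)⟩

end LipschitzPaths

end Riemannian

end LoopDistortion
end

noncomputable section

namespace LoopDistortion

open Set Filter MeasureTheory
open scoped NNReal

/-! ### Mollification of vector-valued maps -/

section Mollify

variable {m : ℕ} {F : Type*} [NormedAddCommGroup F] [NormedSpace ℝ F] [CompleteSpace F]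

/-- Mollification of Lipschitz functions at scale `ε`. -/
lemma exists_mollification {ψ : (Fin m → ℝ) → F} {B : ℝ≥0} (hψ : LipschitzWith B ψ) {ε : ℝ}
    (hε : 0 < ε) :
    ∃ M : (Fin m → ℝ) → F, ContDiff ℝ ∞ M ∧ LipschitzWith B M ∧
      (∀ v, dist (M v) (ψ v) ≤ B * ε) ∧
      ∀ v, (∀ w ∈ Metric.ball v ε, ψ w = ψ v) → M v = ψ v := by
  let φ : ContDiffBump (0 : Fin m → ℝ) := ⟨ε / 2, ε, half_pos hε, half_lt_self hε⟩
  have hφ : φ.rOut = ε := rfl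
  refine ⟨convolution (φ.normed volume) ψ (ContinuousLinearMap.lsmul ℝ ℝ) volume, ?_, ?_, ?_, ?_⟩
  · exact φ.hasCompactSupport_normed.contDiff_convolution_left _ φ.contDiff_normed
      hψ.continuous.locallyIntegrable
  · refine LipschitzWith.of_dist_le_mul fun x y => ?_
    have hint : ∀ x, Integrable (fun t => φ.normed volume t • ψ (x - t)) := by
      intro x
      refine Continuous.integrable_of_hasCompactSupport ?_ φ.hasCompactSupport_normed.smul_right
      exact φ.continuous_normed.smul (hψ.continuous.comp (by fun_prop))
    rw [dist_eq_norm, convolution_def, convolution_def]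
    simp only [ContinuousLinearMap.lsmul_apply]
    rw [← integral_sub (hint x) (hint y)]
    calc _ ≤ ∫ t, φ.normed volume t * (B * dist x y) := by
          refine norm_integral_le_of_norm_le (φ.integrable_normed.mul_const _)
            (Eventually.of_forall fun t => ?_)
          rw [← smul_sub, norm_smul, Real.norm_of_nonneg (φ.nonneg_normed t), ← dist_eq_norm]
          gcongr
          · exact φ.nonneg_normed t
          · exact (hψ.dist_le_mul _ _).trans_eq (by rw [dist_sub_right])
      _ = B * dist x y := by rw [integral_mul_const, φ.integral_normed, one_mul]
  · intro v
    refine φ.dist_normed_convolution_le hψ.continuous.aestronglyMeasurable fun w hw => ?_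
    refine (hψ.dist_le_mul w v).trans ?_
    gcongr
    exact (Metric.mem_ball.1 hw).le
  -- Averages only see the ball of radius `ε`, so values are kept wherever the function is locally
  -- constant at that scale. This preserves basedness later.
  · intro v hv
    exact φ.normed_convolution_eq_right hv

end Mollify

/-! ### Charts with cutoffs for smoothing -/

section SmoothingChart

/-- The data used to smooth a map near a point of the target: a Lipschitz function `ψ` to the model
space, a Lipschitz inverse `inv` over the open set `W`, and a cutoff function `χ` supported in `W`. -/
structure SmoothingChart (d : ℕ) (X : Type u) [MetricSpace X]
    [ChartedSpace (EuclideanSpace ℝ (Fin d)) X] where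
  ψ : X → EuclideanSpace ℝ (Fin d)
  inv : EuclideanSpace ℝ (Fin d) → X
  χ : X → ℝ
  A : ℝ≥0
  B : ℝ≥0
  B' : ℝ≥0
  W : Set X
  N : Set X
  D : Set (EuclideanSpace ℝ (Fin d))
  ρ : ℝ
  ρ_pos : 0 < ρ
  isOpen_W : IsOpen W
  isOpen_N : IsOpen N
  isOpen_D : IsOpen D
  lipschitz_ψ : LipschitzWith B ψ
  lipschitz_χ : LipschitzWith B' χ
  lipschitz_inv : LipschitzOnWith A inv D
  smooth_ψ : ContMDiff (𝓡 d) 𝓘(ℝ, EuclideanSpace ℝ (Fin d)) ∞ ψ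
  smooth_χ : ContMDiff (𝓡 d) 𝓘(ℝ, ℝ) ∞ χ
  smooth_inv : ContMDiffOn 𝓘(ℝ, EuclideanSpace ℝ (Fin d)) (𝓡 d) ∞ inv D
  χ_nonneg : ∀ y, 0 ≤ χ y
  χ_le_one : ∀ y, χ y ≤ 1
  χ_one : ∀ y ∈ N, χ y = 1
  tsupport_subset : tsupport χ ⊆ W
  ball_subset : ∀ y ∈ W, Metric.ball (ψ y) ρ ⊆ D
  left_inv : ∀ y ∈ W, inv (ψ y) = y

/-- Concentric chart balls of radii `R`, `2R`, `3R`, `4R`, `5R = r` are used. The cutoff is `1` on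
the first and supported in the closure of the second; `ψ` agrees with the chart on the third. A
displacement by less than `R` from there stays in the fourth, well inside the domain of the
Lipschitz inverse. Compactness of `X` makes `ψ` and the cutoff globally Lipschitz. -/
lemma exists_smoothingChart {d : ℕ} {X : Type u} [MetricSpace X] [CompactSpace X]
    [ChartedSpace (EuclideanSpace ℝ (Fin d)) X] [IsManifold (𝓡 d) ∞ X]
    [Bundle.RiemannianBundle (fun x : X => TangentSpace (𝓡 d) x)]
    [IsContinuousRiemannianBundle (EuclideanSpace ℝ (Fin d)) (fun x : X => TangentSpace (𝓡 d) x)]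
    [IsRiemannianManifold (𝓡 d) X] (x : X) : ∃ S : SmoothingChart d X, x ∈ S.N := by
  obtain ⟨A, r, hr, hsub, hA⟩ := exists_lipschitzOnWith_extChartAt_symm (𝓡 d) x
  set φ := extChartAt (𝓡 d) x with hφ
  set R := r / 5 with hR
  have hR0 : 0 < R := by positivity
  let b : SmoothBumpFunction (𝓡 d) x :=
    { rIn := 3 * R, rOut := 4 * R, rIn_pos := by positivity, rIn_lt_rOut := by linarith
      closedBall_subset := inter_subset_left.trans
        ((Metric.closedBall_subset_ball (by simp only [hR]; linarith)).trans hsub) }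
  let c : SmoothBumpFunction (𝓡 d) x :=
    { rIn := R, rOut := 2 * R, rIn_pos := by positivity, rIn_lt_rOut := by linarith
      closedBall_subset := inter_subset_left.trans
        ((Metric.closedBall_subset_ball (by simp only [hR]; linarith)).trans hsub) }
  have hψ : ContMDiff (𝓡 d) 𝓘(ℝ, EuclideanSpace ℝ (Fin d)) ∞ fun y => b y • φ y :=
    b.contMDiff_smul contMDiffOn_extChartAt
  have hχ : ContMDiff (𝓡 d) 𝓘(ℝ, ℝ) ∞ c := c.contMDiff
  obtain ⟨B, hB⟩ := exists_lipschitzWith_of_contMDiff (hψ.of_le (by simp))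
  obtain ⟨B', hB'⟩ := exists_lipschitzWith_of_contMDiff (hχ.of_le (by simp))
  have hbφ : ∀ y ∈ φ.source ∩ φ ⁻¹' Metric.ball (φ x) (3 * R), b y • φ y = φ y := by
    rintro y ⟨hy, hy'⟩
    rw [b.one_of_dist_le (by rwa [hφ, extChartAt_source] at hy) (Metric.mem_ball.1 hy').le, one_smul]
  refine ⟨{
    ψ := fun y => b y • φ y
    inv := φ.symm
    χ := c
    A := A
    B := B
    B' := B'
    W := φ.source ∩ φ ⁻¹' Metric.ball (φ x) (3 * R)
    N := φ.source ∩ φ ⁻¹' Metric.ball (φ x) R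
    D := Metric.ball (φ x) r
    ρ := R
    ρ_pos := hR0
    isOpen_W := isOpen_extChartAt_preimage' x Metric.isOpen_ball
    isOpen_N := isOpen_extChartAt_preimage' x Metric.isOpen_ball
    isOpen_D := Metric.isOpen_ball
    lipschitz_ψ := hB
    lipschitz_χ := hB'
    lipschitz_inv := hA
    smooth_ψ := hψ
    smooth_χ := hχ
    smooth_inv := (contMDiffOn_extChartAt_symm x).mono hsub
    χ_nonneg := fun y => c.nonneg
    χ_le_one := fun y => c.le_one
    χ_one := fun y hy => c.one_of_dist_le (by rw [← extChartAt_source (𝓡 d)]; exact hy.1)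
      (Metric.mem_ball.1 hy.2).le
    tsupport_subset := ?_
    ball_subset := ?_
    left_inv := ?_ }, ?_⟩
  · refine c.tsupport_subset_symm_image_closedBall.trans ?_
    rintro _ ⟨e, ⟨he, -⟩, rfl⟩
    have he' : e ∈ Metric.ball (φ x) (3 * R) :=
      Metric.closedBall_subset_ball (by change 2 * R < 3 * R; linarith) he
    have het : e ∈ φ.target := hsub (Metric.ball_subset_ball (by simp only [hR]; linarith) he')
    refine ⟨φ.map_target het, ?_⟩
    rw [mem_preimage, φ.right_inv het]
    exact he'
  · intro y hy
    simp only [hbφ y hy]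
    refine Metric.ball_subset_ball' ?_
    have := Metric.mem_ball.1 hy.2
    simp only [hR] at this ⊢
    linarith
  · intro y hy
    simp only [hbφ y hy]
    exact φ.left_inv hy.1
  · exact ⟨mem_extChartAt_source x, Metric.mem_ball_self hR0⟩

end SmoothingChart

end LoopDistortion
end

noncomputable section

namespace LoopDistortion

open Set Filter MeasureTheory
open scoped NNReal

/-! ### Smoothing over one chart -/

section SmoothingStep

variable {d m : ℕ} {X : Type u} [MetricSpace X] [ChartedSpace (EuclideanSpace ℝ (Fin d)) X]

/-- Smoothness of a map from a Euclidean cube to `X` at a point. -/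
abbrev SmoothAt (d : ℕ) {X : Type u} [MetricSpace X] [ChartedSpace (EuclideanSpace ℝ (Fin d)) X]
    (f : (Fin m → ℝ) → X) (v : Fin m → ℝ) : Prop :=
  ContMDiffAt 𝓘(ℝ, Fin m → ℝ) (𝓡 d) ∞ f v

/-- The map `f` is equal to `x₀` near and outside the boundary of the cube. -/
def IsBased (x₀ : X) (f : (Fin m → ℝ) → X) : Prop :=
  ∃ c < 1, ∀ v, c ≤ cubeRadius v → f v = x₀

/-- Homotopy through maps that are equal to `x₀` near and outside the boundary of the cube. -/
def BasedHomotopic (x₀ : X) (f g : (Fin m → ℝ) → X) : Prop :=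
  ∃ h : unitInterval × (Fin m → ℝ) → X, Continuous h ∧ (∀ v, h (0, v) = f v) ∧
    (∀ v, h (1, v) = g v) ∧ ∀ s v, 1 ≤ cubeRadius v → h (s, v) = x₀

lemma cubeRadius_le_add_dist (v w : Fin m → ℝ) : cubeRadius v ≤ cubeRadius w + 2 * dist v w := by
  have h : (fun i => 2 * v i - 1) = (fun i => 2 * w i - 1) + (2 : ℝ) • (v - w) := by
    ext i
    simp only [Pi.add_apply, Pi.smul_apply, Pi.sub_apply, smul_eq_mul]
    ring
  unfold cubeRadius
  rw [h, dist_eq_norm]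
  refine (norm_add_le _ _).trans ?_
  rw [norm_smul]
  norm_num

open Classical in
-- In the chart, `ψ ∘ f` is moved towards its mollification `M` by the fraction `s * χ (f v)`, and
-- `inv` carries the result back. Nothing moves where `χ ∘ f` vanishes, so the result glues with
-- `f`. Over `N` the endpoint is `inv ∘ M`, which is smooth. Elsewhere the formula involves only `f`
-- and smooth maps, so smooth points of `f` remain smooth.
theorem SmoothingChart.exists_step (S : SmoothingChart d X) {x₀ : X} {f : (Fin m → ℝ) → X}
    {L : ℝ≥0} (hf : LipschitzWith L f) (hf0 : IsBased x₀ f) {η : ℝ} (hη : 0 < η) :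
    ∃ g : (Fin m → ℝ) → X, LipschitzWith ((1 + S.A * (3 * S.B + S.B')) * L) g ∧
      (∀ v, dist (g v) (f v) ≤ η) ∧ IsBased x₀ g ∧ BasedHomotopic x₀ f g ∧
      (∀ v, SmoothAt d f v → SmoothAt d g v) ∧ ∀ v, f v ∈ S.N → SmoothAt d g v := by
  obtain ⟨c, hc1, hc⟩ := hf0
  have hA0 : (0 : ℝ) ≤ S.A := S.A.2
  -- The three bounds keep the interpolation inside `D`, bound by `1` the factor that multiplies the
  -- variation of `χ`, and make the displacement in `X` at most `η`.
  set δ : ℝ := min (S.ρ / 2) (min 1 (η / (S.A + 1))) with hδ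
  have hδ0 : 0 < δ := by
    have := S.ρ_pos
    positivity
  have hδρ : δ < S.ρ := (min_le_left _ _).trans_lt (half_lt_self S.ρ_pos)
  have hδ1 : δ ≤ 1 := (min_le_right _ _).trans (min_le_left _ _)
  have hδη : S.A * δ ≤ η := by
    have h1 : δ ≤ η / (S.A + 1) := (min_le_right _ _).trans (min_le_right _ _)
    rw [le_div_iff₀ (by positivity)] at h1
    nlinarith
  -- An `ε`-ball changes `cubeRadius` by less than `(1 - c) / 2`, so around points of radius at
  -- least `(1 + c) / 2` it sees only the value `x₀`. The second bound gives the displacement `δ`.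
  set ε : ℝ := min ((1 - c) / 4) (δ / (S.B * L + 1)) with hε
  have hε0 : 0 < ε := lt_min (by linarith) (by positivity)
  have hBε : ((S.B * L : ℝ≥0) : ℝ) * ε ≤ δ := by
    have h1 : ε ≤ δ / (S.B * L + 1) := min_le_right _ _
    rw [le_div_iff₀ (by positivity)] at h1
    push_cast
    nlinarith
  have hψf : LipschitzWith (S.B * L) (S.ψ ∘ f) := S.lipschitz_ψ.comp hf
  obtain ⟨M, hMs, hML, hMd, hMc⟩ := exists_mollification hψf hε0
  have hMδ : ∀ v, dist (M v) (S.ψ (f v)) ≤ δ := fun v => (hMd v).trans hBε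
  let u : ℝ → (Fin m → ℝ) → EuclideanSpace ℝ (Fin d) := fun s v =>
    S.ψ (f v) + (s * S.χ (f v)) • (M v - S.ψ (f v))
  let h : ℝ → (Fin m → ℝ) → X := fun s v => if f v ∈ S.W then S.inv (u s v) else f v
  have hW : ∀ s v, f v ∈ S.W → h s v = S.inv (u s v) := fun s v hv => if_pos hv
  have hu_of : ∀ s v, S.χ (f v) = 0 ∨ M v = S.ψ (f v) → u s v = S.ψ (f v) := by
    rintro s v (hv | hv) <;> simp [u, hv]
  have hh_of : ∀ s v, S.χ (f v) = 0 ∨ M v = S.ψ (f v) → h s v = f v := by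
    intro s v hv
    by_cases hvW : f v ∈ S.W
    · rw [hW s v hvW, hu_of s v hv, S.left_inv _ hvW]
    · exact if_neg hvW
  have hopW : IsOpen {v | f v ∈ S.W} := S.isOpen_W.preimage hf.continuous
  have hopT : IsOpen {v | f v ∉ tsupport S.χ} :=
    (isClosed_tsupport S.χ).isOpen_compl.preimage hf.continuous
  have hcover : ∀ v, f v ∈ S.W ∨ f v ∉ tsupport S.χ := fun v =>
    (Classical.em (f v ∈ tsupport S.χ)).imp_left (fun hv => S.tsupport_subset hv)
  have hT : ∀ s v, f v ∉ tsupport S.χ → h s v = f v := fun s v hv =>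
    hh_of s v (Or.inl (image_eq_zero_of_notMem_tsupport hv))
  have hud : ∀ s ∈ Icc (0 : ℝ) 1, ∀ v, dist (u s v) (S.ψ (f v)) ≤ δ := by
    intro s hs v
    simp only [u]
    rw [dist_eq_norm, add_sub_cancel_left, norm_smul, Real.norm_of_nonneg
      (mul_nonneg hs.1 (S.χ_nonneg _)), ← dist_eq_norm]
    refine (mul_le_of_le_one_left dist_nonneg ?_).trans (hMδ v)
    exact mul_le_one₀ hs.2 (S.χ_nonneg _) (S.χ_le_one _)
  have huD : ∀ s ∈ Icc (0 : ℝ) 1, ∀ v, f v ∈ S.W → u s v ∈ S.D := fun s hs v hv =>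
    S.ball_subset _ hv (Metric.mem_ball.2 ((hud s hs v).trans_lt hδρ))
  have h1mem : (1 : ℝ) ∈ Icc (0 : ℝ) 1 := right_mem_Icc.2 zero_le_one
  have hdist : ∀ v, dist (h 1 v) (f v) ≤ η := by
    intro v
    by_cases hv : f v ∈ S.W
    · rw [hW 1 v hv]
      calc dist (S.inv (u 1 v)) (f v) = dist (S.inv (u 1 v)) (S.inv (S.ψ (f v))) := by
            rw [S.left_inv _ hv]
        _ ≤ S.A * dist (u 1 v) (S.ψ (f v)) := S.lipschitz_inv.dist_le_mul _ (huD 1 h1mem v hv) _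
            (S.ball_subset _ hv (Metric.mem_ball_self S.ρ_pos))
        _ ≤ η := (mul_le_mul_of_nonneg_left (hud 1 h1mem v) hA0).trans hδη
    · rw [show h 1 v = f v from if_neg hv, dist_self]
      exact hη.le
  have hfar : ∀ s v, (1 + c) / 2 ≤ cubeRadius v → h s v = x₀ := by
    intro s v hv
    have hball : ∀ w ∈ Metric.ball v ε, f w = x₀ := by
      intro w hw
      apply hc
      have h1 := cubeRadius_le_add_dist v w
      have h2 : dist w v < (1 - c) / 4 := (Metric.mem_ball.1 hw).trans_le (min_le_left _ _)
      rw [dist_comm] at h2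
      linarith
    have hv0 := hball v (Metric.mem_ball_self hε0)
    rw [hh_of s v (Or.inr (hMc v fun w hw => ?_)), hv0]
    rw [Function.comp_apply, Function.comp_apply, hball w hw, hv0]
  have hucont : Continuous fun q : ℝ × (Fin m → ℝ) => u q.1 q.2 := by
    have h1 := hf.continuous
    have h2 := S.lipschitz_ψ.continuous
    have h3 := S.lipschitz_χ.continuous
    have h4 := hML.continuous
    fun_prop
  have hhcont : Continuous fun q : unitInterval × (Fin m → ℝ) => h q.1 q.2 := by
    rw [continuous_iff_continuousAt]
    rintro ⟨s, v⟩
    rcases hcover v with hv | hv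
    · have hnhds : ((fun q : unitInterval × (Fin m → ℝ) => f q.2) ⁻¹' S.W) ∈ 𝓝 (s, v) :=
        (hopW.preimage continuous_snd).mem_nhds hv
      refine ContinuousAt.congr ?_ (mem_of_superset hnhds fun q hq => (hW _ _ hq).symm)
      refine ContinuousAt.comp (f := fun q : unitInterval × (Fin m → ℝ) => u q.1 q.2)
        (g := S.inv) ?_ ?_
      · exact S.lipschitz_inv.continuousOn.continuousAt (S.isOpen_D.mem_nhds (huD s s.2 v hv))
      · exact (hucont.comp (by fun_prop : Continuous fun q : unitInterval × (Fin m → ℝ) =>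
          ((q.1 : ℝ), q.2))).continuousAt
    · have hnhds : ((fun q : unitInterval × (Fin m → ℝ) => f q.2) ⁻¹' (tsupport S.χ)ᶜ) ∈ 𝓝 (s, v) :=
        (hopT.preimage continuous_snd).mem_nhds hv
      exact ContinuousAt.congr (hf.continuous.comp continuous_snd).continuousAt
        (mem_of_superset hnhds fun q hq => (hT _ _ hq).symm)
  -- Product rule: `B` from `ψ ∘ f`, `B'` from the variation of `χ` against a displacement of at
  -- most `1`, and `2B` from the difference of `M` and `ψ ∘ f`.
  have huL : ∀ v w, dist (u 1 v) (u 1 w) ≤ (3 * S.B + S.B') * L * dist v w := by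
    intro v w
    have e : u 1 v - u 1 w = (S.ψ (f v) - S.ψ (f w)) +
        ((S.χ (f v) - S.χ (f w)) • (M v - S.ψ (f v)) +
          S.χ (f w) • ((M v - M w) - (S.ψ (f v) - S.ψ (f w)))) := by
      simp only [u, one_mul]
      module
    have d1 : ‖S.ψ (f v) - S.ψ (f w)‖ ≤ S.B * L * dist v w := by
      rw [← dist_eq_norm]; exact_mod_cast hψf.dist_le_mul v w
    have d2 : ‖M v - M w‖ ≤ S.B * L * dist v w := by
      rw [← dist_eq_norm]; exact_mod_cast hML.dist_le_mul v w
    have d3 : ‖S.χ (f v) - S.χ (f w)‖ ≤ S.B' * L * dist v w := by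
      rw [← dist_eq_norm]; exact_mod_cast (S.lipschitz_χ.comp hf).dist_le_mul v w
    have d4 : ‖M v - S.ψ (f v)‖ ≤ 1 := by
      rw [← dist_eq_norm]; exact (hMδ v).trans hδ1
    have d5 : ‖S.χ (f w)‖ ≤ 1 := by
      rw [Real.norm_of_nonneg (S.χ_nonneg _)]; exact S.χ_le_one _
    rw [dist_eq_norm, e]
    refine (norm_add_le _ _).trans ((add_le_add_right (norm_add_le _ _) _).trans ?_)
    rw [norm_smul, norm_smul]
    have d6 : ‖(M v - M w) - (S.ψ (f v) - S.ψ (f w))‖ ≤ 2 * (S.B * L * dist v w) :=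
      (norm_sub_le _ _).trans (by linarith)
    have d7 := mul_le_mul d3 d4 (norm_nonneg _) (by positivity)
    have d8 := mul_le_mul d5 d6 (norm_nonneg _) zero_le_one
    nlinarith
  have hsm : ∀ v, f v ∈ S.W → ContMDiffAt 𝓘(ℝ, Fin m → ℝ) 𝓘(ℝ, EuclideanSpace ℝ (Fin d)) ∞ (u 1) v →
      SmoothAt d (h 1) v := by
    intro v hv huv
    refine ContMDiffAt.congr_of_eventuallyEq (f := fun w => S.inv (u 1 w)) ?_
      (mem_of_superset (hopW.mem_nhds hv) fun w hw => hW 1 w hw)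
    exact ContMDiffAt.comp v
      (S.smooth_inv.contMDiffAt (S.isOpen_D.mem_nhds (huD 1 h1mem v hv))) huv
  refine ⟨h 1, ?_, hdist, ⟨(1 + c) / 2, by linarith, hfar 1⟩,
    ⟨fun q => h q.1 q.2, hhcont, fun v => ?_, fun v => rfl, fun s v hv => hfar s v (by linarith)⟩,
    ?_, ?_⟩
  · refine lipschitzWith_of_eventually_dist_le fun v => ?_
    have hL0 : (0 : ℝ) ≤ L := L.2
    have hB0 : (0 : ℝ) ≤ S.B := S.B.2
    have hB'0 : (0 : ℝ) ≤ S.B' := S.B'.2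
    rcases hcover v with hv | hv
    · filter_upwards [hopW.mem_nhds hv] with w hw
      rw [hW 1 w hw, hW 1 v hv]
      refine (S.lipschitz_inv.dist_le_mul _ (huD 1 h1mem w hw) _ (huD 1 h1mem v hv)).trans ?_
      refine (mul_le_mul_of_nonneg_left (huL w v) hA0).trans ?_
      push_cast
      have : 0 ≤ L * dist w v := mul_nonneg hL0 dist_nonneg
      nlinarith
    · filter_upwards [hopT.mem_nhds hv] with w hw
      rw [hT 1 w hw, hT 1 v hv]
      refine (hf.dist_le_mul _ _).trans ?_
      gcongr
      exact le_mul_of_one_le_left' (le_add_of_nonneg_right zero_le)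
  · change h 0 v = f v
    by_cases hv : f v ∈ S.W
    · rw [hW 0 v hv, show u 0 v = S.ψ (f v) by simp [u], S.left_inv _ hv]
    · exact if_neg hv
  · intro v hv
    rcases hcover v with hvW | hvT
    · refine hsm v hvW ?_
      have h1 := (S.smooth_ψ.contMDiffAt (x := f v)).comp v hv
      have h2 := (S.smooth_χ.contMDiffAt (x := f v)).comp v hv
      have h3 : ContMDiffAt 𝓘(ℝ, Fin m → ℝ) 𝓘(ℝ, EuclideanSpace ℝ (Fin d)) ∞ M v :=
        hMs.contMDiff.contMDiffAt
      simp only [u, one_mul]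
      exact h1.add (h2.smul (h3.sub h1))
    · exact hv.congr_of_eventuallyEq (mem_of_superset (hopT.mem_nhds hvT) fun w hw => hT 1 w hw)
  · intro v hv
    have hNW : S.N ⊆ S.W := fun y hy => S.tsupport_subset (subset_tsupport _ (by
      rw [Function.mem_support, S.χ_one y hy]; exact one_ne_zero))
    refine hsm v (hNW hv) ?_
    have h3 : ContMDiffAt 𝓘(ℝ, Fin m → ℝ) 𝓘(ℝ, EuclideanSpace ℝ (Fin d)) ∞ M v :=
      hMs.contMDiff.contMDiffAt
    refine h3.congr_of_eventuallyEq (mem_of_superset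
      ((S.isOpen_N.preimage hf.continuous).mem_nhds hv) fun w hw => ?_)
    change u 1 w = M w
    simp only [u, one_mul, S.χ_one _ (show f w ∈ S.N from hw), one_smul, add_sub_cancel]

end SmoothingStep

end LoopDistortion
end

noncomputable section

namespace LoopDistortion

open Set Filter MeasureTheory
open scoped NNReal

/-! ### Smoothing over a finite cover -/

section Smoothing

variable {d m : ℕ} {X : Type u} [MetricSpace X] [ChartedSpace (EuclideanSpace ℝ (Fin d)) X]

/-- The restriction of a map to the unit cube. -/
def cubeRestrict (f : (Fin m → ℝ) → X) (hf : Continuous f) : C(I^ Fin m, X) :=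
  ⟨fun t => f (cubeCoe t), hf.comp continuous_cubeCoe⟩

lemma BasedHomotopic.homotopicWith {x₀ : X} {f g : (Fin m → ℝ) → X} (h : BasedHomotopic x₀ f g)
    (hf : Continuous f) (hg : Continuous g) :
    (cubeRestrict f hf).HomotopicWith (cubeRestrict g hg) BoundaryConst := by
  obtain ⟨H, hH, h0, h1, hb⟩ := h
  exact ⟨{
    toFun := fun q => H (q.1, cubeCoe q.2)
    continuous_toFun := hH.comp (continuous_fst.prodMk (continuous_cubeCoe.comp continuous_snd))
    map_zero_left := fun t => h0 _
    map_one_left := fun t => h1 _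
    prop' := fun s t ht t' ht' => (hb s _ (cubeRadius_of_mem_boundary ht).ge).trans
      (hb s _ (cubeRadius_of_mem_boundary ht').ge).symm }⟩

lemma IsBased.homotopicWith_self [NeZero m] {x₀ : X} {f : (Fin m → ℝ) → X} (h : IsBased x₀ f)
    (hf : Continuous f) : (cubeRestrict f hf).HomotopicWith (cubeRestrict f hf) BoundaryConst := by
  obtain ⟨c, hc, h⟩ := h
  exact BasedHomotopic.homotopicWith ⟨fun q => f q.2, hf.comp continuous_snd, fun _ => rfl,
    fun _ => rfl, fun _ v hv => h v (hc.le.trans hv)⟩ hf hf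

/-- Lipschitz maps from the cube can be smoothed over the part of the cube that they send close to
`S`, at the cost of a constant factor. -/
def SmoothableNear (d m : ℕ) {X : Type u} [MetricSpace X]
    [ChartedSpace (EuclideanSpace ℝ (Fin d)) X] (x₀ : X) (S : Set X) : Prop :=
  ∃ θ > 0, ∃ C : ℝ≥0, ∀ (L : ℝ≥0) (f : (Fin m → ℝ) → X) (η : ℝ) (hf : LipschitzWith L f),
    IsBased x₀ f → 0 < η → ∃ (g : (Fin m → ℝ) → X) (hg : LipschitzWith (C * L) g),
      (∀ v, dist (g v) (f v) ≤ η) ∧ IsBased x₀ g ∧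
      (cubeRestrict f hf.continuous).HomotopicWith (cubeRestrict g hg.continuous) BoundaryConst ∧
      (∀ v, SmoothAt d f v → SmoothAt d g v) ∧
      ∀ v, (∃ y ∈ S, dist (f v) y ≤ θ) → SmoothAt d g v

lemma smoothableNear_empty [NeZero m] (x₀ : X) : SmoothableNear d m x₀ (∅ : Set X) := by
  refine ⟨1, one_pos, 1, fun L f η hf hf0 hη => ⟨f, by rwa [one_mul], fun v => ?_, hf0,
    hf0.homotopicWith_self hf.continuous, fun v hv => hv, by simp⟩⟩
  rw [dist_self]
  exact hη.le

lemma SmoothableNear.mono {x₀ : X} {S T : Set X} (hST : S ⊆ T) (h : SmoothableNear d m x₀ T) :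
    SmoothableNear d m x₀ S := by
  obtain ⟨θ, hθ, C, h⟩ := h
  refine ⟨θ, hθ, C, fun L f η hf hf0 hη => ?_⟩
  obtain ⟨g, hg, h1, h2, h3, h4, h5⟩ := h L f η hf hf0 hη
  exact ⟨g, hg, h1, h2, h3, h4, fun v ⟨y, hy, hv⟩ => h5 v ⟨y, hST hy, hv⟩⟩

/-- Smoothing over `S` moves points by at most `θ' / 2`, so those sent within `θ' / 2` of `T` are
still within `θ'` of it for the second smoothing, which preserves the smoothness already gained. The
Lipschitz factors multiply. -/
lemma SmoothableNear.union {x₀ : X} {S T : Set X} (hS : SmoothableNear d m x₀ S)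
    (hT : SmoothableNear d m x₀ T) : SmoothableNear d m x₀ (S ∪ T) := by
  obtain ⟨θ, hθ, C, hS⟩ := hS
  obtain ⟨θ', hθ', C', hT⟩ := hT
  refine ⟨min θ (θ' / 2), lt_min hθ (half_pos hθ'), C' * C, fun L f η hf hf0 hη => ?_⟩
  obtain ⟨g, hg, h1, h2, h3, h4, h5⟩ :=
    hS L f (min (η / 2) (θ' / 2)) hf hf0 (lt_min (half_pos hη) (half_pos hθ'))
  obtain ⟨g', hg', h1', h2', h3', h4', h5'⟩ := hT _ g (η / 2) hg h2 (half_pos hη)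
  refine ⟨g', by rwa [mul_assoc], fun v => ?_, h2', h3.trans h3', fun v hv => h4' v (h4 v hv), ?_⟩
  · have := (h1 v).trans (min_le_left _ _)
    linarith [dist_triangle (g' v) (g v) (f v), h1' v]
  · rintro v ⟨y, hy | hy, hv⟩
    · exact h4' v (h5 v ⟨y, hy, hv.trans (min_le_left _ _)⟩)
    · refine h5' v ⟨y, hy, ?_⟩
      have h6 := (h1 v).trans (min_le_right _ _)
      have h7 := hv.trans (min_le_right _ _)
      linarith [dist_triangle (g v) (f v) y]

lemma SmoothingChart.smoothableNear (S : SmoothingChart d X) (x₀ : X) {x : X} (hx : x ∈ S.N) :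
    ∃ U ∈ 𝓝 x, SmoothableNear d m x₀ U := by
  obtain ⟨r, hr, hsub⟩ := Metric.isOpen_iff.1 S.isOpen_N x hx
  refine ⟨Metric.ball x (r / 2), Metric.ball_mem_nhds _ (half_pos hr), r / 2, half_pos hr,
    1 + S.A * (3 * S.B + S.B'), fun L f η hf hf0 hη => ?_⟩
  obtain ⟨g, hg, h1, h2, h3, h4, h5⟩ := S.exists_step hf hf0 hη
  refine ⟨g, hg, h1, h2, h3.homotopicWith _ _, h4, fun v ⟨y, hy, hv⟩ => h5 v (hsub ?_)⟩
  have := Metric.mem_ball.1 hy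
  rw [Metric.mem_ball]
  linarith [dist_triangle (f v) y x]

/-- Smoothing of Lipschitz maps from the cube to a compact Riemannian manifold, with linear control
of the Lipschitz constant. -/
theorem exists_smoothing [NeZero m] [CompactSpace X] [IsManifold (𝓡 d) ∞ X]
    [Bundle.RiemannianBundle (fun x : X => TangentSpace (𝓡 d) x)]
    [IsContinuousRiemannianBundle (EuclideanSpace ℝ (Fin d)) (fun x : X => TangentSpace (𝓡 d) x)]
    [IsRiemannianManifold (𝓡 d) X] (x₀ : X) :
    ∃ C : ℝ≥0, ∀ (L : ℝ≥0) (f : (Fin m → ℝ) → X) (hf : LipschitzWith L f), IsBased x₀ f →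
      ∃ (g : (Fin m → ℝ) → X) (hg : LipschitzWith (C * L) g), IsBased x₀ g ∧
      (cubeRestrict f hf.continuous).HomotopicWith (cubeRestrict g hg.continuous) BoundaryConst ∧
      ContMDiff 𝓘(ℝ, Fin m → ℝ) (𝓡 d) ∞ g := by
  obtain ⟨θ, hθ, C, h⟩ : SmoothableNear d m x₀ (univ : Set X) := by
    -- The number of charts depends only on `X`, so the product of the factors is independent of `L`
    -- and `f`.
    refine isCompact_univ.induction_on (smoothableNear_empty x₀) (fun s t hst h => h.mono hst)
      (fun s t h h' => h.union h') fun x _ => ?_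
    obtain ⟨S, hS⟩ := exists_smoothingChart (d := d) x
    obtain ⟨U, hU, h⟩ := S.smoothableNear x₀ hS
    exact ⟨U, mem_nhdsWithin_of_mem_nhds hU, h⟩
  refine ⟨C, fun L f hf hf0 => ?_⟩
  obtain ⟨g, hg, -, h2, h3, -, h5⟩ := h L f 1 hf hf0 one_pos
  exact ⟨g, hg, h2, h3, fun v => h5 v ⟨f v, mem_univ _, by rw [dist_self]; exact hθ.le⟩⟩

end Smoothing

end LoopDistortion
end

noncomputable section

namespace LoopDistortion

open Set Filter MeasureTheory
open scoped NNReal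

/-! ### The collapse of the cube is Lipschitz -/

section Collapse

variable {m : ℕ}

/-- The angle between unit vectors is at most `π / 2` times their distance. -/
lemma angle_le_mul_dist {V : Type*} [NormedAddCommGroup V] [InnerProductSpace ℝ V] {p q : V}
    (hp : ‖p‖ = 1) (hq : ‖q‖ = 1) :
    InnerProductGeometry.angle p q ≤ Real.pi / 2 * dist p q := by
  set θ := InnerProductGeometry.angle p q with hθ
  have h0 : 0 ≤ θ := InnerProductGeometry.angle_nonneg _ _
  have h1 : θ ≤ Real.pi := InnerProductGeometry.angle_le_pi _ _
  have h2 : dist p q ^ 2 = (2 * Real.sin (θ / 2)) ^ 2 := by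
    have := InnerProductGeometry.norm_sub_sq_eq_norm_sq_add_norm_sq_sub_two_mul_norm_mul_norm_mul_cos_angle p q
    rw [hp, hq, ← hθ] at this
    have hc : Real.cos θ = 1 - 2 * Real.sin (θ / 2) ^ 2 := by
      have := Real.cos_two_mul (θ / 2)
      rw [mul_div_cancel₀ _ two_ne_zero] at this
      linarith [Real.sin_sq_add_cos_sq (θ / 2)]
    rw [dist_eq_norm, sq, this, hc]
    ring
  -- Jordan's inequality, applied to the half angle of the chord.
  have hs : 2 / Real.pi * (θ / 2) ≤ Real.sin (θ / 2) :=
    Real.mul_le_sin (by linarith) (by linarith)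
  have hs0 : 0 ≤ Real.sin (θ / 2) :=
    Real.sin_nonneg_of_nonneg_of_le_pi (by linarith) (by linarith)
  have h3 : dist p q = 2 * Real.sin (θ / 2) :=
    (pow_left_inj₀ dist_nonneg (by linarith) two_ne_zero).1 h2
  rw [h3]
  have hpi := Real.pi_pos
  calc θ = Real.pi * (2 / Real.pi * (θ / 2)) := by field_simp
    _ ≤ Real.pi * Real.sin (θ / 2) := by gcongr
    _ = _ := by ring

/-- The extension of `collapseVec` to all of `ℝ^m`. -/
def collapseReal (x : Fin m → ℝ) : EuclideanSpace ℝ (Fin (m + 1)) :=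
  let v : Fin m → ℝ := fun i => 2 * x i - 1
  let b : ℝ := ∏ i, (1 - v i ^ 2)
  let q : ℝ := ∑ i, v i ^ 2
  WithLp.toLp 2 (Fin.snoc (fun i => 2 * b * v i / (q + b ^ 2)) ((q - b ^ 2) / (q + b ^ 2)))

/-- The denominator never vanishes: its first term is zero only at the centre, where the product
equals `1`. -/
lemma contDiff_collapseReal : ContDiff ℝ 1 (collapseReal (m := m)) := by
  have hpos : ∀ x : Fin m → ℝ,
      ∑ i, (2 * x i - 1) ^ 2 + (∏ i, (1 - (2 * x i - 1) ^ 2)) ^ 2 ≠ 0 := by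
    intro x
    have hq0 : 0 ≤ ∑ i, (2 * x i - 1) ^ 2 := Finset.sum_nonneg fun i _ => sq_nonneg _
    rcases hq0.eq_or_lt with h | h
    · have hz : ∀ i, (2 * x i - 1) ^ 2 = 0 := fun i =>
        (Finset.sum_eq_zero_iff_of_nonneg fun i _ => sq_nonneg _).1 h.symm i (Finset.mem_univ i)
      simp [hz]
    · positivity
  have hb : ContDiff ℝ 1 fun x : Fin m → ℝ => ∏ i, (1 - (2 * x i - 1) ^ 2) :=
    contDiff_prod fun i _ => by fun_prop
  have hq : ContDiff ℝ 1 fun x : Fin m → ℝ => ∑ i, (2 * x i - 1) ^ 2 :=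
    ContDiff.sum fun i _ => by fun_prop
  have hd := hq.add (hb.pow 2)
  rw [contDiff_euclidean]
  intro j
  induction j using Fin.lastCases with
  | last =>
    simp only [collapseReal, Fin.snoc_last]
    exact (hq.sub (hb.pow 2)).div hd hpos
  | cast i =>
    simp only [collapseReal, Fin.snoc_castSucc]
    exact ((contDiff_const.mul hb).mul (by fun_prop)).div hd hpos

/-- The quotient map from the cube to the round sphere is Lipschitz. -/
lemma exists_angle_collapse_le (m : ℕ) : ∃ K : ℝ≥0, ∀ t t' : I^ Fin m,
    InnerProductGeometry.angle (collapse t).1 (collapse t').1 ≤ K * dist t t' := by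
  obtain ⟨K, hK⟩ := ((contDiff_collapseReal (m := m)).locallyLipschitz.locallyLipschitzOn
    (s := Icc 0 1)).exists_lipschitzOnWith_of_compact isCompact_Icc
  refine ⟨(Real.pi / 2).toNNReal * K, fun t t' => ?_⟩
  refine (angle_le_mul_dist (norm_collapseVec t) (norm_collapseVec t')).trans ?_
  rw [NNReal.coe_mul, mul_assoc, Real.coe_toNNReal _ (by positivity)]
  have hmem : ∀ t : I^ Fin m, cubeCoe t ∈ Icc (0 : Fin m → ℝ) 1 := fun t =>
    ⟨fun i => (t i).2.1, fun i => (t i).2.2⟩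
  exact mul_le_mul_of_nonneg_left (hK.dist_le_mul _ (hmem t) _ (hmem t')) (by positivity)

end Collapse

/-! ### Making a Lipschitz map based -/

section Padding

variable {m : ℕ} {X : Type u} [MetricSpace X]

lemma lipschitzWith_cubeRadius : LipschitzWith 2 (cubeRadius (m := m)) :=
  LipschitzWith.of_le_add_mul 2 fun v w => cubeRadius_le_add_dist v w

lemma lipschitzWith_cubeExpand (c : ℝ≥0) : LipschitzWith c (cubeExpand (m := m) c) := by
  refine LipschitzWith.of_dist_le_mul fun v w => ?_
  refine (dist_pi_le_iff (by positivity)).2 fun i => ?_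
  refine ((LipschitzWith.projIcc _).dist_le_mul _ _).trans ?_
  rw [NNReal.coe_one, one_mul, dist_add_left, Real.dist_eq, ← mul_sub, abs_mul, NNReal.abs_eq,
    sub_sub_sub_cancel_right, ← Real.dist_eq]
  gcongr
  exact dist_le_pi_dist v w i

/-- A Lipschitz map from the cube which is constant on the boundary can be changed into one which
has the value `x₀` near and outside the boundary. -/
lemma exists_isBased [NeZero m] {K K' : ℝ≥0} {x₁ x₀ : X} (F : C(I^ Fin m, X))
    (hF : LipschitzWith K F) (hb : ∀ t ∈ Cube.boundary (Fin m), F t = x₁)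
    (h : LipJoined K' x₁ x₀) :
    ∃ (f : (Fin m → ℝ) → X) (hf : LipschitzWith (2 * K + 8 * K') f), IsBased x₀ f ∧
      F.HomotopicWith (cubeRestrict f hf.continuous) BoundaryConst := by
  obtain ⟨β, hβ, rfl, rfl⟩ := h
  -- Double speed makes the path reach `x₀` halfway through the collar, at radius `3 / 4`. The
  -- factor `8` is this `2` times the Lipschitz constant `4` of the collar coordinate.
  let γ : ℝ → X := fun r => β (projIcc (0 : ℝ) 1 zero_le_one (2 * r))
  have hγ : LipschitzWith (2 * K') γ := by
    refine LipschitzWith.of_dist_le_mul fun r s => ?_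
    refine (hβ.dist_le_mul _ _).trans ?_
    have h1 := (LipschitzWith.projIcc (zero_le_one (α := ℝ))).dist_le_mul (2 * r) (2 * s)
    rw [NNReal.coe_one, one_mul, Real.dist_eq (2 * r), ← mul_sub, abs_mul, abs_two,
      ← Real.dist_eq] at h1
    push_cast
    calc _ ≤ (K' : ℝ) * (2 * dist r s) := mul_le_mul_of_nonneg_left h1 K'.2
      _ = _ := by ring
  have hbγ : ∀ t ∈ Cube.boundary (Fin m), F t = γ 0 := by
    intro t ht
    simp [γ, hb t ht]
  have hf : LipschitzWith (2 * K + 8 * K') (cubePad F γ) := by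
    refine lipschitzWith_of_le_of_ge continuous_cubeRadius (c := 1 / 2) ?_ ?_
    · refine LipschitzOnWith.weaken (K := K * 2) ?_ (by rw [mul_comm]; exact le_self_add)
      refine LipschitzOnWith.of_dist_le_mul fun v hv w hw => ?_
      have key : ∀ v : Fin m → ℝ, cubeRadius v ≤ 1 / 2 → cubePad F γ v = F (cubeExpand 2 v) :=
        fun v hv => if_pos hv
      rw [key v hv, key w hw]
      exact (hF.comp (lipschitzWith_cubeExpand 2)).dist_le_mul v w
    · refine LipschitzOnWith.weaken (K := 2 * K' * (2 * 2)) ?_ ?_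
      · refine LipschitzOnWith.of_dist_le_mul fun v hv w hw => ?_
        rw [cubePad_of_half_le hbγ hv, cubePad_of_half_le hbγ hw]
        have hr : LipschitzWith (2 * 2) fun v : Fin m → ℝ => 2 * cubeRadius v - 1 :=
          LipschitzWith.of_dist_le_mul fun v w => ?_
        · exact (hγ.comp hr).dist_le_mul v w
        rw [Real.dist_eq, sub_sub_sub_cancel_right, ← mul_sub, abs_mul, abs_two, ← Real.dist_eq]
        have := lipschitzWith_cubeRadius.dist_le_mul v w
        push_cast at this ⊢
        linarith
      · rw [show 2 * K' * (2 * 2) = 8 * K' by ring]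
        exact le_add_self
  refine ⟨cubePad F γ, hf, ⟨3 / 4, by norm_num, fun v hv => ?_⟩,
    homotopicWith_cubePad F γ hγ.continuous hbγ _ fun t => rfl⟩
  rw [cubePad_of_half_le hbγ (by linarith)]
  simp only [γ]
  rw [projIcc_of_right_le _ (by linarith)]

end Padding

/-! ### Maps of small diameter are null-homotopic -/

section SmallMaps

/-- In a compact manifold, maps of small diameter that are constant on the boundary of the cube are
homotopic to constant maps. -/
lemma exists_homotopicWith_const_of_dist_le {m : ℕ} {E : Type*} [NormedAddCommGroup E]
    [NormedSpace ℝ E] {H : Type*} [TopologicalSpace H] (J : ModelWithCorners ℝ E H)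
    [J.Boundaryless] (X : Type u) [MetricSpace X] [CompactSpace X] [ChartedSpace H X] :
    ∃ ρ > 0, ∀ F : C(I^ Fin m, X), BoundaryConst F → (∀ t, dist (F t) (F 0) ≤ ρ) →
      F.HomotopicWith (ContinuousMap.const (I^ Fin m) (F 0)) BoundaryConst := by
  obtain ⟨ρ, hρ, h⟩ : ∃ ρ > 0, ∀ x ∈ (univ : Set X), ∀ F : C(I^ Fin m, X), F 0 = x →
      BoundaryConst F → (∀ t, dist (F t) (F 0) ≤ ρ) →
      F.HomotopicWith (ContinuousMap.const (I^ Fin m) (F 0)) BoundaryConst := by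
    refine isCompact_univ.induction_on (p := fun S => ∃ ρ > 0, ∀ x ∈ S, ∀ F : C(I^ Fin m, X),
      F 0 = x → BoundaryConst F → (∀ t, dist (F t) (F 0) ≤ ρ) →
      F.HomotopicWith (ContinuousMap.const (I^ Fin m) (F 0)) BoundaryConst) ?_ ?_ ?_ ?_
    · exact ⟨1, one_pos, by simp⟩
    · rintro S T hST ⟨ρ, hρ, h⟩
      exact ⟨ρ, hρ, fun x hx => h x (hST hx)⟩
    · rintro S T ⟨ρ, hρ, h⟩ ⟨ρ', hρ', h'⟩
      refine ⟨min ρ ρ', lt_min hρ hρ', ?_⟩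
      rintro x (hx | hx) F hF hb hd
      · exact h x hx F hF hb fun t => (hd t).trans (min_le_left _ _)
      · exact h' x hx F hF hb fun t => (hd t).trans (min_le_right _ _)
    · intro x _
      set φ := extChartAt J x with hφ
      obtain ⟨r, hr, hsub⟩ := Metric.isOpen_iff.1 (show IsOpen φ.target from isOpen_extChartAt_target x) (φ x)
        (mem_extChartAt_target x)
      have hU : φ.source ∩ φ ⁻¹' Metric.ball (φ x) r ∈ 𝓝 x :=
        (isOpen_extChartAt_preimage' x Metric.isOpen_ball).mem_nhds
          ⟨mem_extChartAt_source x, Metric.mem_ball_self hr⟩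
      obtain ⟨ρ, hρ, hρU⟩ := Metric.mem_nhds_iff.1 hU
      refine ⟨Metric.ball x (ρ / 2), mem_nhdsWithin_of_mem_nhds (Metric.ball_mem_nhds _ (by
        positivity)), ρ / 4, by positivity, ?_⟩
      intro y hy F hF hb hd
      have hmem : ∀ t, F t ∈ φ.source ∩ φ ⁻¹' Metric.ball (φ x) r := by
        intro t
        refine hρU (Metric.mem_ball.2 ?_)
        have h1 := hd t
        rw [hF] at h1
        linarith [dist_triangle (F t) y x, Metric.mem_ball.1 hy]
      have hcF : Continuous fun t => φ (F t) :=
        (continuousOn_extChartAt x).comp_continuous F.continuous fun t => (hmem t).1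
      -- The whole image lies over one convex chart ball, so the straight-line homotopy to `φ (F 0)`
      -- is available and stays constant on the boundary.
      have hl : ∀ q : unitInterval × (I^ Fin m),
          AffineMap.lineMap (k := ℝ) (φ (F q.2)) (φ (F 0)) (q.1 : ℝ) ∈ φ.target := by
        intro q
        apply hsub
        apply (convex_ball _ _).segment_subset (hmem q.2).2 (hmem 0).2
        rw [segment_eq_image_lineMap]
        exact ⟨_, q.1.2, rfl⟩
      refine ⟨{
        toFun := fun q => φ.symm (AffineMap.lineMap (k := ℝ) (φ (F q.2)) (φ (F 0)) (q.1 : ℝ))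
        continuous_toFun := (continuousOn_extChartAt_symm x).comp_continuous ?_ hl
        map_zero_left := fun t => ?_
        map_one_left := fun t => ?_
        prop' := fun s t ht t' ht' => ?_ }⟩
      · simp only [AffineMap.lineMap_apply_module]
        have h1 : Continuous fun q : unitInterval × (I^ Fin m) => (q.1 : ℝ) := by fun_prop
        exact ((continuous_const.sub h1).smul (hcF.comp continuous_snd)).add
          (h1.smul continuous_const)
      · simp only [Icc.coe_zero, AffineMap.lineMap_apply_zero]
        exact φ.left_inv (hmem t).1
      · simp only [Icc.coe_one, AffineMap.lineMap_apply_one]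
        exact φ.left_inv (hmem 0).1
      · change φ.symm (AffineMap.lineMap (k := ℝ) (φ (F t)) (φ (F 0)) (s : ℝ)) =
          φ.symm (AffineMap.lineMap (k := ℝ) (φ (F t')) (φ (F 0)) (s : ℝ))
        rw [hb t ht t' ht']
  exact ⟨ρ, hρ, fun F => h (F 0) (mem_univ _) F rfl⟩

end SmallMaps

end LoopDistortion
end

noncomputable section

namespace LoopDistortion

open Set Filter MeasureTheory
open scoped NNReal

/-! ### Volume, length and smoothness of the Hurewicz chain -/

section ChainGeometry

variable {d n : ℕ} {X : Type u} [MetricSpace X] {x₀ : X}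

lemma Chain.volume_eq_sum {Z : Chain (Path x₀ x₀) n} {s : Finset (Simplex (Path x₀ x₀) n)}
    (hs : Z.support ⊆ s) :
    Z.volume = ∑ ρ ∈ s, ENNReal.ofReal (abs (Z ρ : ℝ)) * simplexVolume ρ :=
  Finsupp.sum_of_support_subset _ hs _ (by simp)

/-- Distinct permutations may give the same simplex of loops, and then coefficients combine; hence
the chain volume is bounded by subadditivity. -/
lemma Chain.volume_add_le (Z Z' : Chain (Path x₀ x₀) n) :
    (Z + Z').volume ≤ Z.volume + Z'.volume := by
  classical
  rw [volume_eq_sum (Finsupp.support_add (g₁ := Z) (g₂ := Z')),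
    volume_eq_sum (Finset.subset_union_left (s₁ := Z.support) (s₂ := Z'.support)),
    volume_eq_sum (Finset.subset_union_right (s₁ := Z.support) (s₂ := Z'.support)),
    ← Finset.sum_add_distrib]
  refine Finset.sum_le_sum fun ρ _ => ?_
  rw [← add_mul, ← ENNReal.ofReal_add (abs_nonneg _) (abs_nonneg _)]
  gcongr
  rw [Finsupp.add_apply, Rat.cast_add]
  exact abs_add_le _ _

/-- The generalized loop defined by a map which is equal to `x₀` on the boundary of the cube. -/
def IsBased.genLoop {m : ℕ} {f : (Fin m → ℝ) → X} (h : IsBased x₀ f) (hf : Continuous f) :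
    Ω^ (Fin m) X x₀ :=
  ⟨cubeRestrict f hf, fun t ht => by
    obtain ⟨c, hc, h⟩ := h
    exact h _ (hc.le.trans (cubeRadius_of_mem_boundary ht).ge)⟩

variable {f : (Fin (n + 1) → ℝ) → X} {K : ℝ≥0}

/-- The loops `s ↦ f (s, v)`. -/
def sliceMap (f : (Fin (n + 1) → ℝ) → X) (hf : Continuous f) (v : Fin n → ℝ) :
    C(unitInterval, X) :=
  ⟨fun s => f (Fin.cons (s : ℝ) v : Fin (n + 1) → ℝ), hf.comp
    (continuous_pi (Fin.cases continuous_subtype_val fun _ => continuous_const))⟩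

lemma loopAdjoint_toContinuousMap (h : IsBased x₀ f) (hf : Continuous f) (t : I^ Fin n) :
    (loopAdjoint (h.genLoop hf) t).toContinuousMap = sliceMap f hf (cubeCoe t) := by
  ext s
  change f (cubeCoe (Fin.cons s t : Fin (n + 1) → unitInterval)) = f _
  congr 1
  ext i
  refine Fin.cases ?_ (fun j => ?_) i <;> rfl

lemma lipschitzWith_sliceMap (hf : LipschitzWith K f) :
    LipschitzWith K (sliceMap f hf.continuous) := by
  refine LipschitzWith.of_dist_le_mul fun v w => ?_
  refine (ContinuousMap.dist_le (by positivity)).2 fun s => ?_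
  refine (hf.dist_le_mul _ _).trans ?_
  gcongr
  refine (dist_pi_le_iff dist_nonneg).2 (Fin.cases ?_ fun i => ?_)
  · simp
  · simpa using dist_le_pi_dist v w i

/-- The simplex lies in the image of the unit cube under the `K`-Lipschitz slice map. In the sup
metric the Hausdorff measure of that cube is its Lebesgue measure `1`. -/
lemma simplexVolume_le (h : IsBased x₀ f) (hf : LipschitzWith K f) (p : Equiv.Perm (Fin n)) :
    simplexVolume ((loopAdjoint (h.genLoop hf.continuous)).1.comp (cubeSimplex p)) ≤
      (K : ℝ≥0∞) ^ n := by
  let : MeasurableSpace C(unitInterval, X) := borel _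
  have : BorelSpace C(unitInterval, X) := ⟨rfl⟩
  have hsub : (range fun w => (((loopAdjoint (h.genLoop hf.continuous)).1.comp
      (cubeSimplex p)) w).toContinuousMap) ⊆ sliceMap f hf.continuous '' Icc 0 1 := by
    rintro _ ⟨w, rfl⟩
    exact ⟨cubeCoe (cubeSimplex p w), ⟨fun i => (cubeSimplex p w i).2.1,
      fun i => (cubeSimplex p w i).2.2⟩, (loopAdjoint_toContinuousMap h hf.continuous _).symm⟩
  have hvol : Measure.hausdorffMeasure (n : ℝ) (Icc (0 : Fin n → ℝ) 1) = 1 := by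
    have := hausdorffMeasure_pi_real (ι := Fin n)
    rw [Fintype.card_fin] at this
    rw [this, Real.volume_Icc_pi]
    simp
  unfold simplexVolume
  refine (measure_mono hsub).trans
    (((lipschitzWith_sliceMap hf).hausdorffMeasure_image_le (Nat.cast_nonneg n) _).trans ?_)
  rw [hvol, mul_one, ENNReal.rpow_natCast]

lemma volume_hurewiczChain_le (h : IsBased x₀ f) (hf : LipschitzWith K f) :
    (hurewiczChain (loopAdjoint (h.genLoop hf.continuous))).volume ≤
      (n.factorial : ℝ≥0∞) * (K : ℝ≥0∞) ^ n := by
  refine (Finset.le_sum_of_subadditive Chain.volume Finsupp.sum_zero_index.le Chain.volume_add_le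
    _ _).trans ?_
  refine (Finset.sum_le_card_nsmul _ _ ((K : ℝ≥0∞) ^ n) fun p _ => ?_).trans_eq ?_
  · rw [Chain.volume, Finsupp.sum_single_index (by simp)]
    have : abs (((Equiv.Perm.sign p : ℤ) : ℚ) : ℝ) = 1 := by
      rcases Int.units_eq_one_or (Equiv.Perm.sign p) with hp | hp <;> simp [hp]
    rw [this, ENNReal.ofReal_one, one_mul]
    exact simplexVolume_le h hf p
  · rw [Finset.card_univ, Fintype.card_perm, Fintype.card_fin, nsmul_eq_mul]

lemma exists_of_mem_support_hurewiczChain {Y : Type u} [TopologicalSpace Y] {y : Y}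
    {g : Ω^ (Fin n) Y y} {ρ : Simplex Y n} (hρ : ρ ∈ (hurewiczChain g).support) :
    ∃ p : Equiv.Perm (Fin n), ρ = g.1.comp (cubeSimplex p) := by
  classical
  obtain ⟨p, -, hp⟩ := Finset.mem_biUnion.1 (Finsupp.support_finsetSum hρ)
  exact ⟨p, Finset.mem_singleton.1 (Finsupp.support_single_subset hp)⟩

lemma loopLength_loopAdjoint_le (h : IsBased x₀ f) (hf : LipschitzWith K f) (t : I^ Fin n) :
    loopLength (loopAdjoint (h.genLoop hf.continuous) t) ≤ K := by
  have hL : LipschitzWith K fun s : ℝ => f (Fin.cons s (cubeCoe t) : Fin (n + 1) → ℝ) := by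
    refine LipschitzWith.of_dist_le_mul fun s s' => (hf.dist_le_mul _ _).trans ?_
    gcongr
    refine (dist_pi_le_iff dist_nonneg).2 (Fin.cases ?_ fun i => ?_) <;> simp
  have e : (loopAdjoint (h.genLoop hf.continuous) t : unitInterval → X) =
      (fun s : ℝ => f (Fin.cons s (cubeCoe t) : Fin (n + 1) → ℝ)) ∘
        (Subtype.val : unitInterval → ℝ) :=
    funext fun s => congrFun (congrArg DFunLike.coe
      (loopAdjoint_toContinuousMap h hf.continuous t)) s
  have hm : MonotoneOn (Subtype.val : unitInterval → ℝ) univ :=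
    (Subtype.mono_coe _).monotoneOn _
  have hv : eVariationOn (Subtype.val : unitInterval → ℝ) univ ≤ 1 := by
    have := hm.eVariationOn_eq (mem_univ 0) (mem_univ 1)
    have hu : (univ : Set unitInterval) ∩ Icc 0 1 = univ := by
      rw [univ_inter]
      exact eq_univ_of_forall fun s => ⟨s.2.1, s.2.2⟩
    rw [hu] at this
    simpa using this.le
  rw [loopLength, e]
  refine ((hL.lipschitzOnWith (s := univ)).comp_eVariationOn_le (mapsTo_univ _ _)).trans ?_
  exact (mul_le_mul_right hv _).trans_eq (mul_one _)

lemma suplength_hurewiczChain_le (h : IsBased x₀ f) (hf : LipschitzWith K f) :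
    (hurewiczChain (loopAdjoint (h.genLoop hf.continuous))).suplength ≤ K := by
  refine iSup₂_le fun ρ hρ => iSup_le fun w => ?_
  obtain ⟨p, rfl⟩ := exists_of_mem_support_hurewiczChain hρ
  exact loopLength_loopAdjoint_le h hf _

lemma isSmoothSimplex_of_mem_support [ChartedSpace (EuclideanSpace ℝ (Fin d)) X]
    (h : IsBased x₀ f) (hf : Continuous f)
    (hs : ContMDiff 𝓘(ℝ, Fin (n + 1) → ℝ) (𝓡 d) ∞ f) {ρ : Simplex (Path x₀ x₀) n}
    (hρ : ρ ∈ (hurewiczChain (loopAdjoint (h.genLoop hf))).support) : IsSmoothSimplex d ρ := by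
  obtain ⟨p, rfl⟩ := exists_of_mem_support_hurewiczChain hρ
  -- The trivial partition suffices: the adjoint is a globally smooth map composed with one that is
  -- affine in the simplex weights and the loop parameter.
  refine ⟨1, fun i => (i : ℝ), fun i j hij => Nat.cast_lt.2 hij, by simp, by simp,
    fun j => ⟨fun q => f (Fin.cons q.2
      (fun i => ∑ k with (p.symm i).castSucc < k, q.1 k) : Fin (n + 1) → ℝ), ?_, fun w s _ => ?_⟩⟩
  · refine ContMDiff.contMDiffOn (hs.comp (ContDiff.contMDiff ?_))
    refine contDiff_pi.2 (Fin.cases ?_ fun i => ?_)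
    · simp only [Fin.cons_zero]
      exact contDiff_snd
    · simp only [Fin.cons_succ]
      exact ContDiff.sum fun k _ => by fun_prop
  · exact (congrFun (congrArg DFunLike.coe
      (loopAdjoint_toContinuousMap h hf (cubeSimplex p w))) s).symm

end ChainGeometry

end LoopDistortion
end

noncomputable section

namespace LoopDistortion

open Set Filter MeasureTheory
open scoped NNReal

/-! ### Homotopy classes and the trivial case -/

section Distortion

variable {X : Type u} [TopologicalSpace X] {x₀ : X} {n : ℕ} [NeZero n]

lemma homotopyClass_eq_of_homotopicWith [SimplyConnectedSpace X] {g g' : Ω^ (Fin (n + 1)) X x₀}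
    (h : g.1.HomotopicWith g'.1 BoundaryConst) : homotopyClass g = homotopyClass g' :=
  congrArg Additive.ofMul (Quotient.sound (genLoop_homotopic_of_homotopicWith h))

lemma homotopyClass_const : homotopyClass (GenLoop.const : Ω^ (Fin (n + 1)) X x₀) = 0 := rfl

/-- The Hurewicz chain of the constant loop represents both `k • z` and `0 • z`. This lets the zero
chain represent `k • z` when the class is trivial. -/
lemma IsHurewiczImage.smul_eq_zero {α : RatHomotopy x₀ n} {z : RatHomology (Path x₀ x₀) n}
    (hz : IsHurewiczImage α z) {k : ℚ} (hk : k • α = 0) : k • z = 0 := by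
  have h : (1 : ℚ) ⊗ₜ[ℤ] homotopyClass (GenLoop.const : Ω^ (Fin (n + 1)) X x₀) = 0 := by
    rw [homotopyClass_const, TensorProduct.tmul_zero]
  have h1 := represents_hurewiczChain hz (h.trans hk.symm)
  have h2 := represents_hurewiczChain hz (h.trans (zero_smul ℚ α).symm)
  rw [zero_smul] at h2
  exact IsClassOf.unique (K := SingularComplex (Path x₀ x₀)) h1 h2

end Distortion

/-! ### Smooth representatives with linear Lipschitz control -/

section Main

variable {d : ℕ} {X : Type u} [MetricSpace X] [CompactSpace X]
  [SimplyConnectedSpace X] [ChartedSpace (EuclideanSpace ℝ (Fin d)) X] [IsManifold (𝓡 d) ∞ X]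
  [Bundle.RiemannianBundle (fun x : X => TangentSpace (𝓡 d) x)]
  [IsContinuousRiemannianBundle (EuclideanSpace ℝ (Fin d)) (fun x : X => TangentSpace (𝓡 d) x)]
  [IsRiemannianManifold (𝓡 d) X]

variable (d) in
/-- Classes of `L`-Lipschitz maps are classes of smooth generalized loops, with a Lipschitz constant
linear in `L`, or `L` is small and the class is trivial. -/
theorem exists_smooth_genLoop (x₀ : X) (n : ℕ) [NeZero n] :
    ∃ K : ℝ≥0, ∀ (L : ℝ) (f : RoundSphere (n + 1) → X) (a : Additive (π_ (n + 1) X x₀)), 0 < L →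
      IsLipschitzOnSphere f L → SphereClass f a → a = 0 ∨
        ∃ (g : (Fin (n + 1) → ℝ) → X) (hg : LipschitzWith (K * L.toNNReal) g) (hb : IsBased x₀ g),
          ContMDiff 𝓘(ℝ, Fin (n + 1) → ℝ) (𝓡 d) ∞ g ∧
          homotopyClass (hb.genLoop hg.continuous) = a := by
  obtain ⟨A, hA⟩ := exists_angle_collapse_le (n + 1)
  obtain ⟨B, hB⟩ := exists_lipJoined (𝓡 d) x₀
  obtain ⟨ρ, hρ, hsmall⟩ := exists_homotopicWith_const_of_dist_le (m := n + 1) (𝓡 d) X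
  obtain ⟨C, hC⟩ := exists_smoothing (d := d) (m := n + 1) x₀
  refine ⟨C * (2 * A + 8 * B * (Real.pi / ρ).toNNReal), fun L f a hL hf ha => ?_⟩
  obtain ⟨g₀, H, rfl, h0, h1, hbd⟩ := ha
  let F : C(I^ Fin (n + 1), X) := ⟨fun t => H (0, t), by fun_prop⟩
  have hF : ∀ t, F t = f (collapse t) := h0
  have hFb : ∀ t ∈ Cube.boundary (Fin (n + 1)), F t = F 0 := fun t ht =>
    hbd 0 t ht 0 ⟨0, Or.inl rfl⟩
  have hFg : F.HomotopicWith g₀.1 BoundaryConst := ⟨{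
    toContinuousMap := H
    map_zero_left := fun _ => rfl
    map_one_left := h1
    prop' := hbd }⟩
  -- The sphere has diameter `π`. For small `L` the image has small diameter and the class is zero;
  -- otherwise `1 ≤ (π / ρ) * L`, which absorbs the additive collar term `8 * B`.
  rcases le_total (L * Real.pi) ρ with hLρ | hLρ
  · left
    have h2 : F.HomotopicWith (ContinuousMap.const _ (F 0)) BoundaryConst := by
      refine hsmall F (fun t ht t' ht' => (hFb t ht).trans (hFb t' ht').symm) fun t => ?_
      rw [hF, hF]
      refine (hf _ _).trans (le_trans ?_ hLρ)
      exact mul_le_mul_of_nonneg_left (InnerProductGeometry.angle_le_pi _ _) hL.le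
    exact homotopyClass_eq_of_homotopicWith (g' := GenLoop.const)
      ((hFg.symm.trans h2).trans (homotopicWith_const (F 0) x₀))
  · right
    have hFL : LipschitzWith (A * L.toNNReal) F := by
      refine LipschitzWith.of_dist_le_mul fun t t' => ?_
      rw [hF, hF]
      refine (hf _ _).trans ?_
      rw [NNReal.coe_mul, Real.coe_toNNReal _ hL.le, mul_comm (A : ℝ), mul_assoc]
      exact mul_le_mul_of_nonneg_left (hA t t') hL.le
    obtain ⟨f₁, hf₁, hb₁, hFf₁⟩ := exists_isBased F hFL hFb (hB (F 0))
    obtain ⟨g, hg, hb, hf₁g, hs⟩ := hC _ f₁ hf₁ hb₁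
    have h8 : B ≤ B * (Real.pi / ρ).toNNReal * L.toNNReal := by
      rw [mul_assoc, ← Real.toNNReal_mul (by positivity)]
      refine le_mul_of_one_le_right' ?_
      rw [Real.one_le_toNNReal, div_mul_eq_mul_div, le_div_iff₀ hρ]
      linarith
    refine ⟨g, hg.weaken ?_, hb, hs, ?_⟩
    · rw [mul_assoc]
      gcongr
      calc 2 * (A * L.toNNReal) + 8 * B
          ≤ 2 * (A * L.toNNReal) + 8 * (B * (Real.pi / ρ).toNNReal * L.toNNReal) := by gcongr
        _ = _ := by ring
    · exact homotopyClass_eq_of_homotopicWith ((hf₁g.symm.trans hFf₁.symm).trans hFg)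

end Main

end LoopDistortion
end

theorem proposition6p3 {d : ℕ} {X : Type u} [MetricSpace X] [CompactSpace X]
    [SimplyConnectedSpace X] [ChartedSpace (EuclideanSpace ℝ (Fin d)) X] [IsManifold (𝓡 d) ∞ X]
    [Bundle.RiemannianBundle (fun x : X => TangentSpace (𝓡 d) x)]
    [IsContMDiffRiemannianBundle (𝓡 d) ∞ (EuclideanSpace ℝ (Fin d))
      (fun x : X => TangentSpace (𝓡 d) x)]
    [IsRiemannianManifold (𝓡 d) X] (x₀ : X) (n : ℕ) [NeZero n] :
    ∃ C : ℝ, 0 < C ∧ ∀ (α : LoopDistortion.RatHomotopy x₀ n)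
      (z : LoopDistortion.RatHomology (Path x₀ x₀) n), LoopDistortion.IsHurewiczImage α z →
        ∀ L : ℝ, 0 < L →
          LoopDistortion.distortion α L ≤ LoopDistortion.homologicalDistortion d z (C * L) := by
  have : IsContinuousRiemannianBundle (EuclideanSpace ℝ (Fin d))
      (fun x : X => TangentSpace (𝓡 d) x) := by
    obtain ⟨g, hg, h⟩ := IsContMDiffRiemannianBundle.exists_contMDiff (IB := 𝓡 d) (n := ∞)
      (F := EuclideanSpace ℝ (Fin d)) (E := fun x : X => TangentSpace (𝓡 d) x)
    exact ⟨⟨g, hg.continuous, h⟩⟩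
  obtain ⟨K, hK⟩ := LoopDistortion.exists_smooth_genLoop d x₀ n
  have hfac : (1 : ℝ) ≤ n.factorial := by exact_mod_cast n.factorial_pos
  have hK0 : (0 : ℝ) ≤ K := K.2
  -- The volume bound `n! * (K * L) ^ n` is at most `(n! * (K + 1) * L) ^ n`, since `n! ≤ n! ^ n`
  -- for `n ≥ 1`. The `+ 1` only ensures positivity.
  refine ⟨n.factorial * (K + 1), by positivity, fun α z hz L hL => ?_⟩
  refine iSup₂_le fun k hk => ?_
  obtain ⟨f, a, hf, ha, hak⟩ := hk
  refine le_iSup₂_of_le k ?_ le_rfl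
  rcases hK L f a hL hf ha with rfl | ⟨g, hg, hb, hs, rfl⟩
  -- Here `k • α = 0`, so `k • z = 0` and the zero chain is admissible for every `L`.
  · rw [TensorProduct.tmul_zero] at hak
    refine ⟨0, by simp, ?_, by simp [LoopDistortion.Chain.suplength],
      by simp [LoopDistortion.Chain.volume]⟩
    rw [hz.smul_eq_zero hak.symm]
    exact LoopDistortion.represents_zero _ _
  · have hKL : ((K * L.toNNReal : NNReal) : ℝ≥0∞) = ENNReal.ofReal (K * L) := by
      rw [ENNReal.ofReal_mul hK0, ENNReal.ofReal_coe_nnreal, ENNReal.coe_mul]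
      rfl
    have hle : (K : ℝ) * L ≤ (K + 1) * L := by nlinarith
    refine ⟨_, fun ρ hρ => LoopDistortion.isSmoothSimplex_of_mem_support hb hg.continuous hs hρ,
      LoopDistortion.represents_hurewiczChain hz hak,
      (LoopDistortion.suplength_hurewiczChain_le hb hg).trans ?_,
      (LoopDistortion.volume_hurewiczChain_le hb hg).trans ?_⟩
    · rw [hKL]
      refine ENNReal.ofReal_le_ofReal (hle.trans ?_)
      rw [mul_assoc]
      exact le_mul_of_one_le_left (by positivity) hfac
    · rw [hKL, ← ENNReal.ofReal_pow (by positivity), ← ENNReal.ofReal_natCast,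
        ← ENNReal.ofReal_mul (by positivity), mul_assoc, mul_pow (n.factorial : ℝ)]
      refine ENNReal.ofReal_le_ofReal ?_
      exact mul_le_mul (le_self_pow₀ hfac (NeZero.ne n)) (pow_le_pow_left₀ (by positivity) hle n)
        (by positivity) (by positivity)
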